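/- **Setting.** Let $S\in\mathbb R^{n_1\times n_1}$, $F\in\mathbb R^{n_2\times n_2}$, $\sigma>0$, $1<\alpha<2$, and let $g_i:\mathbb R^{n_1}\times\mathbb R^{n_2}\to\mathbb R^{n_i}$ $(i=1,2)$ with $g_i(0,0)=0$. Assume, with $|\cdot|$ the Euclidean norm: (A1) there are $\gamma_s>0$, $\gamma_f<0$ with $|e^{St}x|\le e^{\gamma_s t}|x|$ for $t\le 0$, $x\in\mathbb R^{n_1}$, and $|e^{Ft}y|\le e^{\gamma_f t}|y|$ for $t\ge 0$, $y\in\mathbb R^{n_2}$; (A2) there is $K>0$ with $|g_i(x_1,y_1)-g_i(x_2,y_2)|\le K(|x_1-x_2|+|y_1-y_2|)$, $i=1,2$; (A3) $K<-\gamma_f$. Fix $\gamma>0$ with $K<-(\gamma+\gamma_f)$. Let $\Omega$ be the space of càdlàg functions $\omega:\mathbb R\to\mathbb R^{n_2}$ with $\omega(0)=0$, with the $\sigma$-algebra generated by the evaluations, let $\theta_t\omega=\omega(\cdot+t)-\omega(t)$, and let $\mathbb P$ be a probability measure under which $L_t(\omega)=\omega(t)$, $t\in\mathbb R$, is a two-sided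 strictly $\alpha$-stable Lévy process (independent stationary increments and $L_c\stackrel d= c^{1/\alpha}L_1$ for all $c>0$). Put $$\eta^{\frac1\varepsilon}(\omega)=\varepsilon^{-\frac1\alpha}\int_{-\infty}^0 e^{-Fs/\varepsilon}\,dL_s(\omega),\qquad \xi(\omega)=\int_{-\infty}^0 e^{-Fs}\,dL_s(\omega).$$ For $\beta\in\mathbb R$ let $C_\beta^-$ be the set of continuous $\phi=(x,y):(-\infty,0]\to\mathbb R^{n_1}\times\mathbb R^{n_2}$ with $\sup_{t\le0}e^{-\beta t}|x(t)|<\infty$ and $\sup_{t\le0}e^{-\beta t}|y(t)|<\infty$. Let $\mathcal M^\varepsilon(\omega)$ be the set of those $(x_0,y_0)$ for which the solution on $(-\infty,0]$ of $$d\hat x=S\hat x\,dt+g_1(\hat x,\hat y+\sigma\eta^{\frac1\varepsilon}(\theta_t\omega))\,dt,\quad d\hat y=\tfrac1\varepsilon F\hat y\,dt+\tfrac1\varepsilon g_2(\hat x,\hat y+\sigma\eta^{\frac1\varepsilon}(\theta_t\omega))\,dt$$ with value $(x_0,y_0)$ at $t=0$ lies in $C^-_{-\gamma/\varepsilon}$.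 Let $\tilde{\mathcal M}^\varepsilon(\omega)$ be the set of those $(x_0,y_0)$ for which the solution on $(-\infty,0]$ of $$d\tilde x=\varepsilon S\tilde x\,dt+\varepsilon g_1(\tilde x,\tilde y+\sigma\xi(\theta_t\omega))\,dt,\quad d\tilde y=F\tilde y\,dt+g_2(\tilde x,\tilde y+\sigma\xi(\theta_t\omega))\,dt$$ with value $(x_0,y_0)$ at $t=0$ lies in $C^-_{-\gamma}$. Let $$\hat h^\varepsilon(\omega,x_0)=\frac1\varepsilon\int_{-\infty}^0e^{-Fs/\varepsilon}g_2(\hat x(s),\hat y(s)+\sigma\eta^{\frac1\varepsilon}(\theta_s\omega))\,ds,$$ where $(\hat x,\hat y)\in C^-_{-\gamma/\varepsilon}$ is the unique solution of $$\hat x(t)=e^{St}x_0+\int_0^te^{S(t-s)}g_1(\hat x(s),\hat y(s)+\sigma\eta^{\frac1\varepsilon}(\theta_s\omega))\,ds,\quad \hat y(t)=\frac1\varepsilon\int_{-\infty}^te^{F(t-s)/\varepsilon}g_2(\hat x(s),\hat y(s)+\sigma\eta^{\frac1\varepsilon}(\theta_s\omega))\,ds,\quad t\le 0,$$ and let $$\tilde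 h^\varepsilon(\omega,x_0)=\int_{-\infty}^0e^{-Fs}g_2(\tilde x(s),\tilde y(s)+\sigma\xi(\theta_s\omega))\,ds,$$ where $(\tilde x,\tilde y)\in C^-_{-\gamma}$ is the unique solution of $$\tilde x(t)=e^{\varepsilon St}x_0+\varepsilon\int_0^te^{\varepsilon S(t-s)}g_1(\tilde x(s),\tilde y(s)+\sigma\xi(\theta_s\omega))\,ds,\quad \tilde y(t)=\int_{-\infty}^te^{F(t-s)}g_2(\tilde x(s),\tilde y(s)+\sigma\xi(\theta_s\omega))\,ds,\quad t\le 0.$$ **Lemma.** There is $\delta>0$, depending only on $K,\gamma,\gamma_s,\gamma_f$, such that for every $\varepsilon\in(0,\delta)$: for $\mathbb P$-almost every $\omega$ all the objects above are well defined (the integrals $\eta^{\frac1\varepsilon}(\theta_t\omega)$ and $\xi(\theta_t\omega)$ converge for all $t\in\mathbb R$, and the two systems of integral equations are uniquely solvable for all $x_0$), and $\mathcal M^\varepsilon(\omega)=\{(x_0,\hat h^\varepsilon(\omega,x_0)):x_0\in\mathbb R^{n_1}\}$, $\tilde{\mathcal M}^\varepsilon(\omega)=\{(x_0,\tilde h^\varepsilon(\omega,x_0)):x_0\in\mathbb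 R^{n_1}\}$. These slow manifolds coincide in distribution: the random fields $x_0\mapsto\hat h^\varepsilon(\omega,x_0)$ and $x_0\mapsto\tilde h^\varepsilon(\omega,x_0)$ have the same law (on the product $\sigma$-algebra of $(\mathbb R^{n_2})^{\mathbb R^{n_1}}$), and in particular, for every $x_0\in\mathbb R^{n_1}$, $$\hat h^\varepsilon(\omega,x_0)\stackrel d=\tilde h^\varepsilon(\omega,x_0).$$ -/

import Mathlib

open MeasureTheory ProbabilityTheory Filter Topology Set

noncomputable section

namespace SlowFast

/-- `ℝⁿ` with the Euclidean norm. -/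
abbrev Euc (n : ℕ) : Type := EuclideanSpace ℝ (Fin n)

/-! ### The path space, the shift, and two-sided stable Lévy noise -/

/-- `ω` is right-continuous and has left limits at every time `t ∈ ℝ`. -/
def IsCadlag {n : ℕ} (ω : ℝ → Euc n) : Prop :=
  ∀ t : ℝ, Tendsto ω (𝓝[>] t) (𝓝 (ω t)) ∧ ∃ l, Tendsto ω (𝓝[<] t) (𝓝 l)

/-- The space `𝒟₀(ℝ, ℝⁿ)` of càdlàg functions `ω : ℝ → ℝⁿ` with `ω 0 = 0`.
As a subtype it carries the trace of the product `σ`-algebra, generated by the evaluations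
`ω ↦ ω t`; this is also the Borel `σ`-algebra of Skorokhod's topology. -/
abbrev PathSpace (n : ℕ) : Type := {ω : ℝ → Euc n // IsCadlag ω ∧ ω 0 = 0}

theorem IsCadlag.shift {n : ℕ} {ω : ℝ → Euc n} (h : IsCadlag ω) (t : ℝ) :
    IsCadlag (fun s => ω (s + t) - ω t) := by
  intro s
  obtain ⟨h₁, l, h₂⟩ := h (s + t)
  have hc : Tendsto (fun r : ℝ => r + t) (𝓝 s) (𝓝 (s + t)) :=
    (continuous_id.add continuous_const).tendsto s
  refine ⟨(h₁.comp ?_).sub_const _, l - ω t, (h₂.comp ?_).sub_const _⟩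
  · refine tendsto_nhdsWithin_of_tendsto_nhds_of_eventually_within _
      (hc.mono_left nhdsWithin_le_nhds) ?_
    filter_upwards [self_mem_nhdsWithin] with r hr
    simpa using hr
  · refine tendsto_nhdsWithin_of_tendsto_nhds_of_eventually_within _
      (hc.mono_left nhdsWithin_le_nhds) ?_
    filter_upwards [self_mem_nhdsWithin] with r hr
    simpa using hr

/-- The shift `θ_t ω = ω(· + t) - ω(t)`. -/
def shift {n : ℕ} (t : ℝ) (ω : PathSpace n) : PathSpace n :=
  ⟨fun s => ω.1 (s + t) - ω.1 t, ω.2.1.shift t, by simp⟩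

/-- Under the probability measure `P` on `𝒟₀`, the coordinate process `L_t(ω) = ω(t)`, `t ∈ ℝ`,
is a two-sided strictly `α`-stable Lévy process. (It starts at `0` and has càdlàg paths by the
choice of the path space.) -/
structure IsStableLevy {n : ℕ} (α : ℝ) (P : Measure (PathSpace n)) : Prop where
  indep_increments : HasIndepIncrements (fun (t : ℝ) (ω : PathSpace n) => ω.1 t) P
  stationary_increments : ∀ s h : ℝ, 0 ≤ h →
    IdentDistrib (fun ω : PathSpace n => ω.1 (s + h) - ω.1 s) (fun ω => ω.1 h) P P
  stable : ∀ c : ℝ, 0 < c →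
    IdentDistrib (fun ω : PathSpace n => ω.1 c) (fun ω => c ^ (1 / α) • ω.1 1) P P

/-! ### Integrals against a path -/

/-- `I` is the Riemann–Stieltjes integral `∫_a^b Φ(s) dω(s)` (for `a ≤ b`): the limit of the sums
`∑ Φ(τ_i) (ω(t_{i+1}) - ω(t_i))`, `t_i ≤ τ_i ≤ t_{i+1}`, as the mesh of the partition tends
to `0`. For continuously differentiable `Φ` it exists for every càdlàg `ω`. -/
def HasStieltjesIntegral {n : ℕ} (Φ : ℝ → Euc n →L[ℝ] Euc n) (ω : ℝ → Euc n)
    (a b : ℝ) (I : Euc n) : Prop :=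
  ∀ r : ℝ, 0 < r → ∃ δ : ℝ, 0 < δ ∧ ∀ (N : ℕ) (t τ : ℕ → ℝ), t 0 = a → t N = b →
    (∀ i < N, t i ≤ τ i ∧ τ i ≤ t (i + 1) ∧ t (i + 1) - t i < δ) →
      ‖(∑ i ∈ Finset.range N, Φ (τ i) (ω (t (i + 1)) - ω (t i))) - I‖ < r

/-- `I` is the improper integral `∫_{-∞}^0 Φ(s) dω(s)`. -/
def HasStieltjesIntegralIic {n : ℕ} (Φ : ℝ → Euc n →L[ℝ] Euc n) (ω : ℝ → Euc n)
    (I : Euc n) : Prop :=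
  ∃ J : ℝ → Euc n, (∀ u ≤ 0, HasStieltjesIntegral Φ ω u 0 (J u)) ∧ Tendsto J atBot (𝓝 I)

open Classical in
/-- The value of `∫_{-∞}^0 Φ(s) dω(s)` (and `0` where the integral does not converge). -/
def stieltjesIntegralIic {n : ℕ} (Φ : ℝ → Euc n →L[ℝ] Euc n) (ω : ℝ → Euc n) : Euc n :=
  if h : ∃ I, HasStieltjesIntegralIic Φ ω I then h.choose else 0

/-! ### The slow-fast system -/

/-- The data of a slow-fast system: the linear maps `S` and `F` (square matrices), the
nonlinearities `g₁`, `g₂` and the noise intensity `σ`. -/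
structure System (n₁ n₂ : ℕ) where
  S : Euc n₁ →L[ℝ] Euc n₁
  F : Euc n₂ →L[ℝ] Euc n₂
  g₁ : Euc n₁ → Euc n₂ → Euc n₁
  g₂ : Euc n₁ → Euc n₂ → Euc n₂
  σ : ℝ

/-- The exponential dichotomy hypothesis on the linear parts. -/
structure System.LinearBounds {n₁ n₂ : ℕ} (D : System n₁ n₂) (γs γf : ℝ) : Prop where
  slow : ∀ t : ℝ, t ≤ 0 → ∀ x : Euc n₁, ‖NormedSpace.exp (t • D.S) x‖ ≤ Real.exp (γs * t) * ‖x‖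
  fast : ∀ t : ℝ, 0 ≤ t → ∀ y : Euc n₂, ‖NormedSpace.exp (t • D.F) y‖ ≤ Real.exp (γf * t) * ‖y‖

/-- The nonlinearities vanish at the origin and satisfy the Lipschitz condition with
constant `K`. -/
structure System.LipschitzNonlinearities {n₁ n₂ : ℕ} (D : System n₁ n₂) (K : ℝ) : Prop where
  g₁_zero : D.g₁ 0 0 = 0
  g₂_zero : D.g₂ 0 0 = 0
  g₁_lip : ∀ (x x' : Euc n₁) (y y' : Euc n₂),
    ‖D.g₁ x y - D.g₁ x' y'‖ ≤ K * (‖x - x'‖ + ‖y - y'‖)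
  g₂_lip : ∀ (x x' : Euc n₁) (y y' : Euc n₂),
    ‖D.g₂ x y - D.g₂ x' y'‖ ≤ K * (‖x - x'‖ + ‖y - y'‖)

/-! ### The Ornstein–Uhlenbeck processes -/

/-- The integrand `s ↦ e^{-Fs/ε}`. -/
def System.kernel {n₁ n₂ : ℕ} (D : System n₁ n₂) (ε : ℝ) : ℝ → Euc n₂ →L[ℝ] Euc n₂ :=
  fun s => NormedSpace.exp ((-s / ε) • D.F)

/-- `η^{1/ε}(ω) = ε^{-1/α} ∫_{-∞}^0 e^{-Fs/ε} dL_s(ω)`. -/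
def System.eta {n₁ n₂ : ℕ} (D : System n₁ n₂) (α ε : ℝ) (ω : PathSpace n₂) : Euc n₂ :=
  ε ^ (-(1 / α)) • stieltjesIntegralIic (D.kernel ε) ω.1

/-- `ξ(ω) = ∫_{-∞}^0 e^{-Fs} dL_s(ω)`. -/
def System.xi {n₁ n₂ : ℕ} (D : System n₁ n₂) (ω : PathSpace n₂) : Euc n₂ :=
  stieltjesIntegralIic (D.kernel 1) ω.1

/-! ### Slow manifolds of `dx = a (S x + g₁(x, y + σ z(t))) dt`,
`dy = b (F y + g₂(x, y + σ z(t))) dt`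

Both random systems are of this form, with a forcing `z : ℝ → ℝ^{n₂}`. -/

/-- `φ` restricted to `(-∞, 0]` belongs to the weighted space `C_β⁻`: it is continuous and
`sup_{t ≤ 0} |e^{-βt} φ(t)| < ∞`. -/
def InWeighted {n : ℕ} (β : ℝ) (φ : ℝ → Euc n) : Prop :=
  ContinuousOn φ (Iic 0) ∧ ∃ C : ℝ, ∀ t ≤ 0, ‖Real.exp (-β * t) • φ t‖ ≤ C

/-- `(x, y)` solves the system on `(-∞, 0]`, with `(x(0), y(0)) = (x₀, y₀)`. -/
structure System.IsBackwardSolution {n₁ n₂ : ℕ} (D : System n₁ n₂) (a b : ℝ) (z : ℝ → Euc n₂)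
    (x₀ : Euc n₁) (y₀ : Euc n₂) (x : ℝ → Euc n₁) (y : ℝ → Euc n₂) : Prop where
  slow_continuous : ContinuousOn x (Iic 0)
  fast_continuous : ContinuousOn y (Iic 0)
  slow_integrable : ∀ t ≤ 0, IntervalIntegrable
    (fun s => D.S (x s) + D.g₁ (x s) (y s + D.σ • z s)) volume 0 t
  fast_integrable : ∀ t ≤ 0, IntervalIntegrable
    (fun s => D.F (y s) + D.g₂ (x s) (y s + D.σ • z s)) volume 0 t
  slow_eq : ∀ t ≤ 0, x t = x₀ + a • ∫ s in (0 : ℝ)..t, (D.S (x s) + D.g₁ (x s) (y s + D.σ • z s))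
  fast_eq : ∀ t ≤ 0, y t = y₀ + b • ∫ s in (0 : ℝ)..t, (D.F (y s) + D.g₂ (x s) (y s + D.σ • z s))

/-- The slow manifold of the system: the set of initial values whose solution belongs
to `C_β⁻`. -/
def System.slowManifold {n₁ n₂ : ℕ} (D : System n₁ n₂) (a b : ℝ) (z : ℝ → Euc n₂) (β : ℝ) :
    Set (Euc n₁ × Euc n₂) :=
  {p | ∃ x y, D.IsBackwardSolution a b z p.1 p.2 x y ∧ InWeighted β x ∧ InWeighted β y}

/-- `(x, y) ∈ C_β⁻` solves the Lyapunov–Perron equations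
`x(t) = e^{aSt} x₀ + a ∫_0^t e^{aS(t-s)} g₁(x(s), y(s) + σ z(s)) ds`,
`y(t) = b ∫_{-∞}^t e^{bF(t-s)} g₂(x(s), y(s) + σ z(s)) ds`, `t ≤ 0`. -/
structure System.IsLyapunovPerron {n₁ n₂ : ℕ} (D : System n₁ n₂) (a b : ℝ) (z : ℝ → Euc n₂)
    (β : ℝ) (x₀ : Euc n₁) (x : ℝ → Euc n₁) (y : ℝ → Euc n₂) : Prop where
  slow_mem : InWeighted β x
  fast_mem : InWeighted β y
  slow_integrable : ∀ t ≤ 0, IntervalIntegrable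
    (fun s => NormedSpace.exp ((a * (t - s)) • D.S) (D.g₁ (x s) (y s + D.σ • z s))) volume 0 t
  fast_integrable : ∀ t ≤ 0, IntegrableOn
    (fun s => NormedSpace.exp ((b * (t - s)) • D.F) (D.g₂ (x s) (y s + D.σ • z s))) (Iic t) volume
  slow_eq : ∀ t ≤ 0, x t = NormedSpace.exp ((a * t) • D.S) x₀ +
    a • ∫ s in (0 : ℝ)..t, NormedSpace.exp ((a * (t - s)) • D.S) (D.g₁ (x s) (y s + D.σ • z s))
  fast_eq : ∀ t ≤ 0, y t =
    b • ∫ s in Iic t, NormedSpace.exp ((b * (t - s)) • D.F) (D.g₂ (x s) (y s + D.σ • z s))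

/-- The Lyapunov–Perron equations have exactly one solution in `C_β⁻`. -/
def System.UniquelySolvable {n₁ n₂ : ℕ} (D : System n₁ n₂) (a b : ℝ) (z : ℝ → Euc n₂)
    (β : ℝ) (x₀ : Euc n₁) : Prop :=
  ∃ x y, D.IsLyapunovPerron a b z β x₀ x y ∧
    ∀ x' y', D.IsLyapunovPerron a b z β x₀ x' y' → EqOn x' x (Iic 0) ∧ EqOn y' y (Iic 0)

open Classical in
/-- `h(x₀) = b ∫_{-∞}^0 e^{-bFs} g₂(x(s), y(s) + σ z(s)) ds`, where `(x, y)` is the solution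
in `C_β⁻` of the Lyapunov–Perron equations (and `0` if there is none). -/
def System.lyapunovPerronMap {n₁ n₂ : ℕ} (D : System n₁ n₂) (a b : ℝ) (z : ℝ → Euc n₂)
    (β : ℝ) (x₀ : Euc n₁) : Euc n₂ :=
  if h : ∃ φ : (ℝ → Euc n₁) × (ℝ → Euc n₂), D.IsLyapunovPerron a b z β x₀ φ.1 φ.2 then
    b • ∫ s in Iic (0 : ℝ), NormedSpace.exp ((-(b * s)) • D.F)
      (D.g₂ (h.choose.1 s) (h.choose.2 s + D.σ • z s))
  else 0

/-! ### The two random systems -/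

/-- The stationary process `t ↦ η^{1/ε}(θ_t ω)`. -/
def System.etaPath {n₁ n₂ : ℕ} (D : System n₁ n₂) (α ε : ℝ) (ω : PathSpace n₂) :
    ℝ → Euc n₂ :=
  fun t => D.eta α ε (shift t ω)

/-- The stationary process `t ↦ ξ(θ_t ω)`. -/
def System.xiPath {n₁ n₂ : ℕ} (D : System n₁ n₂) (ω : PathSpace n₂) : ℝ → Euc n₂ :=
  fun t => D.xi (shift t ω)

/-- The slow manifold `ℳ^ε(ω)` of
`dx̂ = S x̂ dt + g₁(x̂, ŷ + σ η^{1/ε}(θ_t ω)) dt`,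
`dŷ = ε⁻¹ F ŷ dt + ε⁻¹ g₂(x̂, ŷ + σ η^{1/ε}(θ_t ω)) dt`, with weight `β = -γ/ε`. -/
def System.manifoldHat {n₁ n₂ : ℕ} (D : System n₁ n₂) (α γ ε : ℝ) (ω : PathSpace n₂) :
    Set (Euc n₁ × Euc n₂) :=
  D.slowManifold 1 ε⁻¹ (D.etaPath α ε ω) (-γ / ε)

/-- The function `ĥ^ε(ω, x₀)`. -/
def System.hHat {n₁ n₂ : ℕ} (D : System n₁ n₂) (α γ ε : ℝ) (ω : PathSpace n₂)
    (x₀ : Euc n₁) : Euc n₂ :=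
  D.lyapunovPerronMap 1 ε⁻¹ (D.etaPath α ε ω) (-γ / ε) x₀

/-- The slow manifold `ℳ̃^ε(ω)` of
`dx̃ = ε S x̃ dt + ε g₁(x̃, ỹ + σ ξ(θ_t ω)) dt`,
`dỹ = F ỹ dt + g₂(x̃, ỹ + σ ξ(θ_t ω)) dt`, with weight `β = -γ`. -/
def System.manifoldTilde {n₁ n₂ : ℕ} (D : System n₁ n₂) (γ ε : ℝ) (ω : PathSpace n₂) :
    Set (Euc n₁ × Euc n₂) :=
  D.slowManifold ε 1 (D.xiPath ω) (-γ)

/-- The function `h̃^ε(ω, x₀)`. -/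
def System.hTilde {n₁ n₂ : ℕ} (D : System n₁ n₂) (γ ε : ℝ) (ω : PathSpace n₂)
    (x₀ : Euc n₁) : Euc n₂ :=
  D.lyapunovPerronMap ε 1 (D.xiPath ω) (-γ) x₀

/-- The objects attached to the path `ω` are all defined by genuinely convergent integrals and
uniquely solvable equations, and both slow manifolds are the graphs of `ĥ^ε(ω, ·)`
and `h̃^ε(ω, ·)`. -/
structure System.WellDefinedAt {n₁ n₂ : ℕ} (D : System n₁ n₂) (α γ ε : ℝ)
    (ω : PathSpace n₂) : Prop where
  eta_converges : ∀ t : ℝ, ∃ I, HasStieltjesIntegralIic (D.kernel ε) (shift t ω).1 I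
  xi_converges : ∀ t : ℝ, ∃ I, HasStieltjesIntegralIic (D.kernel 1) (shift t ω).1 I
  hat_solvable : ∀ x₀ : Euc n₁, D.UniquelySolvable 1 ε⁻¹ (D.etaPath α ε ω) (-γ / ε) x₀
  tilde_solvable : ∀ x₀ : Euc n₁, D.UniquelySolvable ε 1 (D.xiPath ω) (-γ) x₀
  hat_graph : D.manifoldHat α γ ε ω = {p | p.2 = D.hHat α γ ε ω p.1}
  tilde_graph : D.manifoldTilde γ ε ω = {p | p.2 = D.hTilde γ ε ω p.1}

end SlowFast

end

/-! The theorem is a pathwise identity followed by invariance of `P`. Let `rescale` send ω to the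
path ω'(t) = ε^{-1/α} ω(εt). Strict stability, with independent and stationary increments, makes
this map preserve `P` (`measurePreserving_rescale`). Substituting s → εs in the noise integral gives
η^{1/ε}(θ_{εt} ω) = ξ(θ_t ω') (`etaPath_mul_eq`), and the same change of time carries the
Lyapunov–Perron equations with coefficients (1, 1/ε) driven by ω to those with coefficients (ε, 1)
driven by ω'. Hence ĥ(ω, x₀) = h̃(ω', x₀) for all x₀ at once (`hHat_eq_hTilde_rescale`). This is
checked on Picard iterates (`picard_mul_eq`) and passes to the limit; the same limit gives
measurability of the random field.

For a fixed path everything is deterministic. The Lyapunov–Perron operator contracts the weighted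
space, with a constant at most εK/γ + K/(-(γ+γf)) for both systems (`norm_map_sub_le`), which is
below 1 for small ε. Variation of constants identifies its fixed points with the backward solutions
in the weighted space: for such a solution e^{-bFt} y(t) → 0 as t → -∞, and this determines y(0)
(`isLyapunovPerron`, `slowManifold_eq`).

The forcing has to exist and to lie in the weighted space. Integration by parts replaces the
Stieltjes integral by ∫ A e^{-As} ω(s) ds (`hasStieltjesIntegralIic_exp`), so subexponential growth
of ω at -∞ suffices. Polynomial growth holds almost surely (`ae_growth`). It uses no tail estimate
for stable laws: scaling bounds the probability of a large excursion on a long interval by 1/2,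
independence over unit blocks makes the probability on one block small, and Borel–Cantelli
concludes. -/

noncomputable section

namespace SlowFast

section

/-! ### Regularity of càdlàg paths -/

/-- The smallest point of `ℤ / (k + 1)` that is larger than `t`. -/
def gridAbove (k : ℕ) (t : ℝ) : ℝ := ((⌊t * (k + 1)⌋ : ℝ) + 1) / (k + 1)

theorem lt_gridAbove (k : ℕ) (t : ℝ) : t < gridAbove k t := by
  have hk : (0 : ℝ) < k + 1 := by positivity
  rw [gridAbove, lt_div_iff₀ hk]
  exact Int.lt_floor_add_one _

theorem gridAbove_le (k : ℕ) (t : ℝ) : gridAbove k t ≤ t + 1 / (k + 1) := by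
  have hk : (0 : ℝ) < k + 1 := by positivity
  rw [gridAbove, div_le_iff₀ hk, add_mul, one_div, inv_mul_cancel₀ hk.ne']
  linarith [Int.floor_le (t * ((k : ℝ) + 1))]

theorem tendsto_gridAbove (t : ℝ) :
    Tendsto (fun k : ℕ => gridAbove k t) atTop (𝓝[>] t) := by
  refine tendsto_nhdsWithin_of_tendsto_nhds_of_eventually_within _ ?_
    (Eventually.of_forall fun k => lt_gridAbove k t)
  refine tendsto_of_tendsto_of_tendsto_of_le_of_le tendsto_const_nhds ?_
    (fun k => (lt_gridAbove k t).le) (fun k => gridAbove_le k t)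
  simpa using tendsto_const_nhds.add (tendsto_one_div_add_atTop_nhds_zero_nat (𝕜 := ℝ))

variable {n : ℕ}

theorem measurable_eval (t : ℝ) : Measurable (fun ω : PathSpace n => ω.1 t) :=
  (measurable_pi_apply t).comp measurable_subtype_coe

/-- Right continuity makes the path the limit of its values at the grid points just above t, and for
each mesh only countably many evaluations occur. -/
theorem measurable_path_uncurry :
    Measurable (fun p : PathSpace n × ℝ => p.1.1 p.2) := by
  refine measurable_of_tendsto_metrizable (f := fun (k : ℕ) (p : PathSpace n × ℝ) =>
    p.1.1 (gridAbove k p.2)) (fun k => ?_) ?_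
  · have h : Measurable (fun p : PathSpace n × ℤ => p.1.1 (((p.2 : ℝ) + 1) / (k + 1))) :=
      measurable_from_prod_countable_left fun m => measurable_eval (n := n) (((m : ℝ) + 1) / (k + 1))
    exact h.comp (measurable_fst.prodMk
      (Int.measurable_floor.comp (measurable_snd.mul_const _)))
  · rw [tendsto_pi_nhds]
    exact fun p => (p.1.2.1 p.2).1.comp (tendsto_gridAbove p.2)

theorem measurable_path (ω : PathSpace n) : Measurable ω.1 :=
  measurable_path_uncurry.comp measurable_prodMk_left

theorem IsCadlag.bounded {ω : ℝ → Euc n} (h : IsCadlag ω) (a b : ℝ) :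
    ∃ C, ∀ t ∈ Icc a b, ‖ω t‖ ≤ C := by
  refine (isCompact_Icc (a := a) (b := b)).induction_on
    (p := fun s => ∃ C, ∀ t ∈ s, ‖ω t‖ ≤ C) ⟨0, by simp⟩
    (fun s t hst ⟨C, hC⟩ => ⟨C, fun x hx => hC x (hst hx)⟩)
    (fun s t ⟨C, hC⟩ ⟨C', hC'⟩ => ⟨max C C', ?_⟩) (fun t _ => ?_)
  · rintro x (hx | hx)
    · exact (hC x hx).trans (le_max_left _ _)
    · exact (hC' x hx).trans (le_max_right _ _)
  · obtain ⟨h₁, l, h₂⟩ := h t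
    have e₁ : ∀ᶠ s in 𝓝[>] t, ‖ω s‖ ≤ ‖ω t‖ + 1 :=
      h₁.norm.eventually_le_const (by linarith)
    have e₂ : ∀ᶠ s in 𝓝[<] t, ‖ω s‖ ≤ ‖l‖ + 1 :=
      h₂.norm.eventually_le_const (by linarith)
    have e : ∀ᶠ s in 𝓝 t, ‖ω s‖ ≤ max (‖ω t‖ + 1) (‖l‖ + 1) := by
      rw [← nhdsNE_sup_pure, ← nhdsLT_sup_nhdsGT, eventually_sup, eventually_sup]
      refine ⟨⟨e₂.mono fun s hs => hs.trans (le_max_right _ _),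
        e₁.mono fun s hs => hs.trans (le_max_left _ _)⟩, ?_⟩
      exact le_max_of_le_left (by linarith : ‖ω t‖ ≤ ‖ω t‖ + 1)
    exact ⟨_, mem_nhdsWithin_of_mem_nhds e, _, fun x hx => hx⟩

/-- Each point has a punctured neighbourhood without jumps larger than 1/(k+1), because both
one-sided limits exist there. So these jump times are locally contained in a single point, hence
null, and a countable union over k remains null. -/
theorem IsCadlag.ae_continuousAt {ω : ℝ → Euc n} (h : IsCadlag ω) :
    ∀ᵐ t : ℝ, ContinuousAt ω t := by
  choose h₁ l h₂ using h
  have key : ∀ k : ℕ, ∀ᵐ t : ℝ, dist (ω t) (l t) ≤ 1 / ((k : ℝ) + 1) := by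
    intro k
    have hk : (0 : ℝ) < 1 / ((k : ℝ) + 1) / 2 := by positivity
    have lim : ∀ (t : ℝ) (U : Set ℝ) (c : Euc n), IsOpen U → Tendsto ω (𝓝[U] t) (𝓝 c) →
        ∀ᶠ s in 𝓝[U] t, dist (ω s) (l s) ≤ 1 / ((k : ℝ) + 1) := by
      intro t U c hU hf
      have hb : ∀ᶠ s in 𝓝[U] t, dist (ω s) c ≤ 1 / ((k : ℝ) + 1) / 2 :=
        (tendsto_iff_dist_tendsto_zero.1 hf).eventually_le_const hk
      filter_upwards [hb, eventually_eventually_nhdsWithin.2 hb, self_mem_nhdsWithin]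
        with s hs hs' hsU
      rw [hU.nhdsWithin_eq hsU] at hs'
      have := le_of_tendsto ((h₂ s).dist tendsto_const_nhds) (nhdsWithin_le_nhds hs')
      calc dist (ω s) (l s) ≤ dist (ω s) c + dist (l s) c := dist_triangle_right _ _ _
        _ ≤ _ := by linarith
    refine measure_null_of_locally_null _ fun t _ => ⟨{t}, ?_, by simp⟩
    have e : ∀ᶠ s in 𝓝[≠] t, dist (ω s) (l s) ≤ 1 / ((k : ℝ) + 1) := by
      rw [← nhdsLT_sup_nhdsGT, eventually_sup]
      exact ⟨lim t _ _ isOpen_Iio (h₂ t), lim t _ _ isOpen_Ioi (h₁ t)⟩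
    refine mem_nhdsWithin_iff_eventually.2 ?_
    filter_upwards [eventually_nhdsWithin_iff.1 e] with s hs hs'
    by_contra hst
    exact hs' (hs hst)
  filter_upwards [ae_all_iff.2 key] with t ht
  have h0 : dist (ω t) (l t) ≤ 0 :=
    ge_of_tendsto' tendsto_one_div_add_atTop_nhds_zero_nat ht
  have heq : ω t = l t := dist_le_zero.1 h0
  refine continuousAt_iff_continuous_left'_right'.2 ⟨?_, h₁ t⟩
  show Tendsto _ _ _
  rw [heq]
  exact h₂ t

/-! ### Riemann–Stieltjes integrals of smooth integrands against càdlàg paths -/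

/-- An integrable bound, of small integral, for the oscillation of a path at small scales. -/
theorem exists_oscillation_bound (ω : PathSpace n) (a b : ℝ) (hab : a ≤ b) {r : ℝ} (hr : 0 < r) :
    ∃ δ : ℝ, 0 < δ ∧ ∃ w : ℝ → ℝ, IntervalIntegrable w volume a b ∧
      (∀ s ∈ Icc a b, ∀ u ∈ Icc a b, |u - s| < δ → ‖ω.1 u - ω.1 s‖ ≤ w s) ∧
      ∫ s in a..b, w s < r := by
  -- The enlarged interval contains every point at distance at most 1 from [a, b], and all scales `δ
  -- k` are at most 1.
  obtain ⟨C, hC⟩ := ω.2.1.bounded (a - 1) (b + 1)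
  have hC0 : 0 ≤ C := (norm_nonneg _).trans (hC a ⟨by linarith, by linarith⟩)
  let δ : ℕ → ℝ := fun k => 1 / ((k : ℝ) + 1)
  have hδ : ∀ k, 0 < δ k := fun k => by positivity
  have hδ1 : ∀ k, δ k ≤ 1 := fun k => by
    rw [div_le_one (by positivity)]
    exact le_add_of_nonneg_left k.cast_nonneg
  have hδ0 : Tendsto δ atTop (𝓝 0) := tendsto_one_div_add_atTop_nhds_zero_nat
  -- Restricting the oscillation to rational times keeps it measurable; right continuity recovers
  -- all real times in `hWosc`.
  let W : ℕ → ℝ → ENNReal := fun k s =>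
    ⨆ q : ℚ, indicator {s : ℝ | |(q : ℝ) - s| < δ k} (fun s => ‖ω.1 q - ω.1 s‖ₑ) s
  have hWm : ∀ k, Measurable (W k) := fun k => by
    refine Measurable.iSup fun q => Measurable.indicator ?_ ?_
    · exact (measurable_const.sub (measurable_path ω)).enorm
    · exact measurableSet_lt (by fun_prop) measurable_const
  have hWb : ∀ k, ∀ s ∈ Icc a b, W k s ≤ ENNReal.ofReal (2 * C) := by
    intro k s hs
    refine iSup_le fun q => indicator_apply_le' (fun hq => ?_) fun _ => zero_le
    rw [← ofReal_norm]
    refine ENNReal.ofReal_le_ofReal ((norm_sub_le _ _).trans ?_)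
    rw [mem_ofPred_eq, abs_lt] at hq
    have := hδ1 k
    have h1 := hC q ⟨by linarith [hs.1], by linarith [hs.2]⟩
    have h2 := hC s ⟨by linarith [hs.1], by linarith [hs.2]⟩
    linarith
  have hWtop : ∀ k, ∀ s ∈ Icc a b, W k s ≠ ⊤ := fun k s hs =>
    ((hWb k s hs).trans_lt ENNReal.ofReal_lt_top).ne
  have hWosc : ∀ k, ∀ s ∈ Icc a b, ∀ u, |u - s| < δ k →
      ‖ω.1 u - ω.1 s‖ ≤ (W k s).toReal := by
    intro k s hs u hu
    have hlim : Tendsto (fun v => ‖ω.1 v - ω.1 s‖) (𝓝[>] u) (𝓝 ‖ω.1 u - ω.1 s‖) :=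
      ((ω.2.1 u).1.sub_const _).norm
    refine le_of_tendsto_of_frequently hlim ?_
    have hev : ∀ᶠ v in 𝓝[>] u, |v - s| < δ k :=
      nhdsWithin_le_nhds ((by fun_prop : Continuous fun v : ℝ => |v - s|).tendsto u
        |>.eventually_lt_const hu)
    have hfr : ∃ᶠ v in 𝓝[>] u, v ∈ range ((↑) : ℚ → ℝ) := by
      intro h
      obtain ⟨d, hd, hsub⟩ := (mem_nhdsGT_iff_exists_Ioo_subset' (lt_add_one u)).1 h
      obtain ⟨q, hq⟩ := exists_rat_btwn (mem_Ioi.1 hd)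
      exact hsub hq ⟨q, rfl⟩
    refine (hfr.and_eventually hev).mono ?_
    rintro _ ⟨⟨q, rfl⟩, hq⟩
    rw [← toReal_enorm]
    refine ENNReal.toReal_mono (hWtop k s hs) ?_
    refine le_iSup_of_le q ?_
    rw [indicator_of_mem]
    exact hq
  have hlim : Tendsto (fun k => ∫ s in a..b, (W k s).toReal) atTop (𝓝 (∫ s in a..b, (0 : ℝ))) := by
    refine intervalIntegral.tendsto_integral_filter_of_dominated_convergence (fun _ => 2 * C)
      (Eventually.of_forall fun k => (hWm k).ennreal_toReal.aestronglyMeasurable)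
      (Eventually.of_forall fun k => Eventually.of_forall fun s hs => ?_)
      intervalIntegrable_const ?_
    · rw [uIoc_of_le hab] at hs
      rw [Real.norm_of_nonneg ENNReal.toReal_nonneg]
      exact ENNReal.toReal_le_of_le_ofReal (by positivity) (hWb k s (Ioc_subset_Icc_self hs))
    -- At a continuity point the oscillation tends to 0 with the scale, which is almost everywhere
    -- enough for dominated convergence.
    · filter_upwards [ω.2.1.ae_continuousAt] with s hs _
      rw [Metric.tendsto_atTop]
      intro e he
      obtain ⟨d, hd, hd'⟩ := Metric.continuousAt_iff.1 hs (e / 2) (half_pos he)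
      obtain ⟨N, hN⟩ := eventually_atTop.1 (hδ0.eventually_lt_const hd)
      refine ⟨N, fun k hk => ?_⟩
      have : W k s ≤ ENNReal.ofReal (e / 2) := by
        refine iSup_le fun q => indicator_apply_le' (fun hq => ?_) fun _ => zero_le
        rw [← ofReal_norm, ← dist_eq_norm]
        refine ENNReal.ofReal_le_ofReal (hd' ?_).le
        rw [Real.dist_eq]
        exact lt_trans hq (hN k hk)
      rw [Real.dist_eq, sub_zero, abs_of_nonneg ENNReal.toReal_nonneg]
      exact (ENNReal.toReal_le_of_le_ofReal (by positivity) this).trans_lt (half_lt_self he)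
  rw [intervalIntegral.integral_zero] at hlim
  obtain ⟨k, hk⟩ := (hlim.eventually_lt_const hr).exists
  refine ⟨δ k, hδ k, fun s => (W k s).toReal, ?_, fun s hs u _ hu => hWosc k s hs u hu, hk⟩
  rw [intervalIntegrable_iff]
  refine Measure.integrableOn_of_bounded (M := 2 * C) (by simp)
    (hWm k).ennreal_toReal.aestronglyMeasurable ?_
  refine (ae_restrict_mem measurableSet_uIoc).mono fun s hs => ?_
  rw [uIoc_of_le hab] at hs
  rw [Real.norm_of_nonneg ENNReal.toReal_nonneg]
  exact ENNReal.toReal_le_of_le_ofReal (by positivity) (hWb k s (Ioc_subset_Icc_self hs))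


/-- Integration by parts. On each cell the Riemann term differs from its share of the closed formula
by an integral of Φ' against the oscillation of ω, and the total oscillation is small in L¹ even
though it is not uniformly small near jumps. -/
theorem hasStieltjesIntegral_of_hasDerivAt {Φ Φ' : ℝ → Euc n →L[ℝ] Euc n}
    (hΦ : ∀ s, HasDerivAt Φ (Φ' s) s) (hΦ' : Continuous Φ') (ω : PathSpace n) {a b : ℝ}
    (hab : a ≤ b) :
    HasStieltjesIntegral Φ ω.1 a b
      (Φ b (ω.1 b) - Φ a (ω.1 a) - ∫ s in a..b, Φ' s (ω.1 s)) := by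
  intro r hr
  obtain ⟨M, hM⟩ := (isCompact_Icc (a := a) (b := b)).exists_bound_of_continuousOn
    hΦ'.continuousOn
  have hM0 : 0 ≤ M := (norm_nonneg _).trans (hM a ⟨le_rfl, hab⟩)
  -- Dividing by M + 1 rather than M allows M = 0 and leaves the final inequality strict.
  obtain ⟨δ, hδ, w, hwi, hw, hwr⟩ := exists_oscillation_bound ω a b hab
    (div_pos hr (by linarith : 0 < M + 1))
  obtain ⟨C, hC⟩ := ω.2.1.bounded a b
  have hΦω : ∀ u v, a ≤ u → u ≤ v → v ≤ b →
      IntervalIntegrable (fun s => Φ' s (ω.1 s)) volume u v := by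
    intro u v hu huv hv
    rw [intervalIntegrable_iff]
    refine Measure.integrableOn_of_bounded (M := M * C) (by simp) ?_ ?_
    · exact Measurable.aestronglyMeasurable
        ((isBoundedBilinearMap_apply (𝕜 := ℝ) (E := Euc n) (F := Euc n)).continuous.measurable.comp
          (hΦ'.measurable.prodMk (measurable_path ω)))
    · refine (ae_restrict_mem measurableSet_uIoc).mono fun s hs => ?_
      rw [uIoc_of_le huv] at hs
      have hs' : s ∈ Icc a b := ⟨by linarith [hs.1], by linarith [hs.2]⟩
      exact (ContinuousLinearMap.le_opNorm _ _).trans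
        (mul_le_mul (hM s hs') (hC s hs') (norm_nonneg _) hM0)
  have hΦc : ∀ u v (x : Euc n), IntervalIntegrable (fun s => Φ' s x) volume u v := fun u v x =>
    (hΦ'.clm_apply continuous_const).intervalIntegrable _ _
  have hFTC : ∀ u v (x : Euc n), ∫ s in u..v, Φ' s x = Φ v x - Φ u x := fun u v x =>
    intervalIntegral.integral_eq_sub_of_hasDerivAt
      (fun s _ => by simpa using (hΦ s).clm_apply (hasDerivAt_const s x)) (hΦc u v x)
  refine ⟨δ, hδ, fun N t τ h0 hN hτ => ?_⟩
  have hmono : ∀ i ≤ N, ∀ j ≤ i, t j ≤ t i := by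
    intro i hi
    induction i with
    | zero => intro j hj; rw [Nat.le_zero.1 hj]
    | succ i ih =>
      intro j hj
      rcases Nat.le_succ_iff.1 hj with hj | rfl
      · exact (ih (by omega) j hj).trans ((hτ i (by omega)).1.trans (hτ i (by omega)).2.1)
      · exact le_rfl
  have hmem : ∀ i ≤ N, t i ∈ Icc a b := fun i hi =>
    ⟨h0 ▸ hmono i hi 0 (Nat.zero_le _), hN ▸ hmono N le_rfl i hi⟩
  have hsum : Φ b (ω.1 b) - Φ a (ω.1 a) - ∫ s in a..b, Φ' s (ω.1 s) =
      ∑ i ∈ Finset.range N, (Φ (t (i + 1)) (ω.1 (t (i + 1))) - Φ (t i) (ω.1 (t i)) -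
        ∫ s in t i..t (i + 1), Φ' s (ω.1 s)) := by
    rw [Finset.sum_sub_distrib, Finset.sum_range_sub (fun i => Φ (t i) (ω.1 (t i))),
      intervalIntegral.sum_integral_adjacent_intervals, h0, hN]
    exact fun i hi => hΦω _ _ (hmem i (by omega)).1 (hmono (i + 1) (by omega) i (by omega))
      (hmem (i + 1) (by omega)).2
  have hwsub : ∀ i < N, IntervalIntegrable w volume (t i) (t (i + 1)) := fun i hi => by
    refine hwi.mono_set ?_
    rw [uIcc_of_le hab, uIcc_of_le (hmono (i + 1) (by omega) i (by omega))]
    exact Icc_subset_Icc (hmem i (by omega)).1 (hmem (i + 1) (by omega)).2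
  have hterm : ∀ i < N, ‖Φ (τ i) (ω.1 (t (i + 1)) - ω.1 (t i)) -
      (Φ (t (i + 1)) (ω.1 (t (i + 1))) - Φ (t i) (ω.1 (t i)) -
        ∫ s in t i..t (i + 1), Φ' s (ω.1 s))‖ ≤ M * ∫ s in t i..t (i + 1), w s := by
    intro i hi
    obtain ⟨h1, h2, h3⟩ := hτ i hi
    have ha := (hmem i (by omega)).1
    have hb := (hmem (i + 1) (by omega)).2
    have hsplit : ∫ s in t i..t (i + 1), Φ' s (ω.1 s) =
        (∫ s in t i..τ i, Φ' s (ω.1 s)) + ∫ s in τ i..t (i + 1), Φ' s (ω.1 s) :=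
      (intervalIntegral.integral_add_adjacent_intervals (hΦω _ _ ha h1 (h2.trans hb))
        (hΦω _ _ (ha.trans h1) h2 hb)).symm
    have hw1 : IntervalIntegrable w volume (t i) (τ i) := (hwsub i hi).mono_set (by
      rw [uIcc_of_le h1, uIcc_of_le (h1.trans h2)]; exact Icc_subset_Icc le_rfl h2)
    have hw2 : IntervalIntegrable w volume (τ i) (t (i + 1)) := (hwsub i hi).mono_set (by
      rw [uIcc_of_le h2, uIcc_of_le (h1.trans h2)]; exact Icc_subset_Icc h1 le_rfl)
    -- With ω frozen at t_i on [t_i, τ_i] and at t_{i+1} on [τ_i, t_{i+1}], the integrals of Φ' are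
    -- explicit and reproduce the Riemann term; `est` bounds the cost of freezing.
    have est : ∀ u v y, a ≤ u → u ≤ v → v ≤ b → y ∈ Icc a b → (∀ s ∈ Icc u v, |y - s| < δ) →
        IntervalIntegrable w volume u v →
        ‖(∫ s in u..v, Φ' s (ω.1 s)) - ∫ s in u..v, Φ' s (ω.1 y)‖ ≤ M * ∫ s in u..v, w s := by
      intro u v y hu huv hv hy hys hwuv
      rw [← intervalIntegral.integral_sub (hΦω u v hu huv hv) (hΦc u v _),
        ← intervalIntegral.integral_const_mul]
      refine intervalIntegral.norm_integral_le_of_norm_le huv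
        (Eventually.of_forall fun s hs => ?_) (hwuv.const_mul M)
      have hs' : s ∈ Icc a b := ⟨by linarith [hs.1], by linarith [hs.2]⟩
      rw [← map_sub, ← norm_neg, ← map_neg, neg_sub]
      exact (ContinuousLinearMap.le_opNorm _ _).trans (mul_le_mul (hM s hs')
        (hw s hs' y hy (hys s (Ioc_subset_Icc_self hs))) (norm_nonneg _) hM0)
    have e1 := est (t i) (τ i) (t i) ha h1 (h2.trans hb) (hmem i (by omega))
      (fun s hs => by rw [abs_lt]; constructor <;> linarith [hs.1, hs.2]) hw1
    have e2 := est (τ i) (t (i + 1)) (t (i + 1)) (ha.trans h1) h2 hb (hmem (i + 1) (by omega))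
      (fun s hs => by rw [abs_lt]; constructor <;> linarith [hs.1, hs.2]) hw2
    rw [hFTC] at e1 e2
    rw [← intervalIntegral.integral_add_adjacent_intervals hw1 hw2, mul_add, hsplit]
    refine le_trans (le_of_eq ?_) ((norm_add_le _ _).trans (add_le_add e1 e2))
    congr 1
    simp only [map_sub]
    abel
  rw [hsum, ← Finset.sum_sub_distrib]
  calc _ ≤ ∑ i ∈ Finset.range N, M * ∫ s in t i..t (i + 1), w s :=
        norm_sum_le_of_le _ fun i hi => hterm i (Finset.mem_range.1 hi)
    _ = M * ∫ s in a..b, w s := by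
        rw [← Finset.mul_sum, intervalIntegral.sum_integral_adjacent_intervals hwsub, h0, hN]
    _ ≤ M * (r / (M + 1)) := by gcongr
    _ < r := by
        rw [mul_div_assoc', div_lt_iff₀ (by linarith)]
        nlinarith

theorem HasStieltjesIntegral.unique {Φ : ℝ → Euc n →L[ℝ] Euc n} {ω : ℝ → Euc n} {a b : ℝ}
    (hab : a ≤ b) {I J : Euc n} (hI : HasStieltjesIntegral Φ ω a b I)
    (hJ : HasStieltjesIntegral Φ ω a b J) : I = J := by
  refine eq_of_forall_dist_le fun r hr => ?_
  obtain ⟨δ, hδ, h⟩ := hI (r / 2) (half_pos hr)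
  obtain ⟨δ', hδ', h'⟩ := hJ (r / 2) (half_pos hr)
  obtain ⟨N, hN⟩ := exists_nat_gt ((b - a) / min δ δ')
  have hm : 0 < min δ δ' := lt_min hδ hδ'
  have hN0 : (0 : ℝ) < N := (div_nonneg (sub_nonneg.2 hab) hm.le).trans_lt hN
  have hstep : (b - a) / N < min δ δ' := by
    rw [div_lt_iff₀ hm] at hN
    rw [div_lt_iff₀ hN0]
    linarith
  let t : ℕ → ℝ := fun i => a + i * ((b - a) / N)
  have ht0 : t 0 = a := by simp [t]
  have htN : t N = b := by simp only [t]; field_simp; ring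
  have ht : ∀ i < N, t i ≤ t i ∧ t i ≤ t (i + 1) ∧ t (i + 1) - t i < min δ δ' := by
    intro i _
    have : t (i + 1) = t i + (b - a) / N := by simp only [t]; push_cast; ring
    rw [this]
    have := div_nonneg (sub_nonneg.2 hab) hN0.le
    exact ⟨le_rfl, by linarith, by linarith⟩
  have e := h N t t ht0 htN fun i hi =>
    ⟨(ht i hi).1, (ht i hi).2.1, (ht i hi).2.2.trans_le (min_le_left _ _)⟩
  have e' := h' N t t ht0 htN fun i hi =>
    ⟨(ht i hi).1, (ht i hi).2.1, (ht i hi).2.2.trans_le (min_le_right _ _)⟩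
  rw [← dist_eq_norm, dist_comm] at e
  rw [← dist_eq_norm] at e'
  linarith [dist_triangle I (∑ i ∈ Finset.range N, Φ (t i) (ω (t (i + 1)) - ω (t i))) J]

/-- Uniqueness of the integrals over each [u, 0] makes the choice in `stieltjesIntegralIic`
harmless. -/
theorem HasStieltjesIntegralIic.stieltjesIntegralIic_eq {Φ : ℝ → Euc n →L[ℝ] Euc n}
    {ω : ℝ → Euc n} {I : Euc n} (h : HasStieltjesIntegralIic Φ ω I) :
    stieltjesIntegralIic Φ ω = I := by
  have hex : ∃ I, HasStieltjesIntegralIic Φ ω I := ⟨I, h⟩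
  rw [stieltjesIntegralIic, dif_pos hex]
  obtain ⟨J, hJ, hJt⟩ := h
  obtain ⟨J', hJ', hJt'⟩ := hex.choose_spec
  refine tendsto_nhds_unique (hJt'.congr' ?_) hJt
  filter_upwards [Iic_mem_atBot 0] with u hu
  exact (hJ' u hu).unique hu (hJ u hu)

end

section

variable {n : ℕ}

/-! ### Semigroups of matrices -/

section Semigroup

variable {E : Type*} [NormedAddCommGroup E] [NormedSpace ℝ E] [CompleteSpace E]

theorem exp_add_smul (A : E →L[ℝ] E) (s t : ℝ) (x : E) :
    NormedSpace.exp ((s + t) • A) x = NormedSpace.exp (s • A) (NormedSpace.exp (t • A) x) := by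
  let _ : NormedAlgebra ℚ (E →L[ℝ] E) := NormedAlgebra.restrictScalars ℚ ℝ _
  rw [add_smul, NormedSpace.exp_add_of_commute (((Commute.refl A).smul_left s).smul_right t)]
  rfl

theorem exp_smul_neg_apply (A : E →L[ℝ] E) (t : ℝ) (x : E) :
    NormedSpace.exp (t • A) (NormedSpace.exp ((-t) • A) x) = x := by
  rw [← exp_add_smul]
  simp [NormedSpace.exp_zero]

theorem continuous_exp_smul (A : E →L[ℝ] E) :
    Continuous fun t : ℝ => NormedSpace.exp (t • A) :=
  (differentiable_exp_smul_const ℝ A).continuous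

end Semigroup

/-! ### Ornstein–Uhlenbeck integrals -/

/-- The path `ω` satisfies `|ω(s)| ≤ C e^{-cs}` on the negative half line. -/
def GrowthBound (C c : ℝ) (ω : ℝ → Euc n) : Prop :=
  ∀ s ≤ 0, ‖ω s‖ ≤ C * Real.exp (-(c * s))

theorem GrowthBound.nonneg {C c : ℝ} {ω : ℝ → Euc n} (h : GrowthBound C c ω) : 0 ≤ C := by
  simpa using (norm_nonneg _).trans (h 0 le_rfl)

/-- The factor e^{-ct} in the new constant becomes the weight of the stationary process: it places t
↦ ξ(θ_t ω) in the weighted class with exponent -c. -/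
theorem GrowthBound.shift_of_nonpos {C c : ℝ} {ω : PathSpace n} (hc : 0 < c)
    (h : GrowthBound C c ω.1) {t : ℝ} (ht : t ≤ 0) :
    GrowthBound (2 * C * Real.exp (-(c * t))) c (shift t ω).1 := by
  intro s hs
  have hC := h.nonneg
  have h1 := h (s + t) (by linarith)
  have h2 := h t ht
  rw [show -(c * (s + t)) = -(c * t) + -(c * s) by ring, Real.exp_add] at h1
  have h3 : (1 : ℝ) ≤ Real.exp (-(c * s)) := Real.one_le_exp (by nlinarith)
  have h4 : 0 ≤ C * Real.exp (-(c * t)) := by positivity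
  refine (norm_sub_le _ _).trans ((add_le_add h1 h2).trans ?_)
  nlinarith

/-- For positive t the shifted path also sees ω on [0, t], where a càdlàg path is bounded. No
control of the constant in t is needed for mere convergence. -/
theorem GrowthBound.exists_shift {C c : ℝ} {ω : PathSpace n} (hc : 0 < c)
    (h : GrowthBound C c ω.1) (t : ℝ) : ∃ C', GrowthBound C' c (shift t ω).1 := by
  obtain ⟨B, hB⟩ := ω.2.1.bounded 0 |t|
  have hB0 : 0 ≤ B := (norm_nonneg _).trans (hB 0 ⟨le_rfl, abs_nonneg t⟩)
  have hC := h.nonneg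
  refine ⟨C * Real.exp (-(c * t)) + B + ‖ω.1 t‖, fun s hs => ?_⟩
  have h3 : (1 : ℝ) ≤ Real.exp (-(c * s)) := Real.one_le_exp (by nlinarith)
  have h5 : 0 ≤ C * Real.exp (-(c * t)) := by positivity
  have h6 := norm_nonneg (ω.1 t)
  refine (norm_sub_le _ _).trans ?_
  rcases le_or_gt (s + t) 0 with hst | hst
  · have h1 := h (s + t) hst
    rw [show -(c * (s + t)) = -(c * t) + -(c * s) by ring, Real.exp_add] at h1
    nlinarith
  · have h1 := hB (s + t) ⟨hst.le, by linarith [le_abs_self t]⟩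
    nlinarith

/-- The integral `∫_{-∞}^0 A e^{-As} ω(s) ds`. -/
def ouIntegral (A : Euc n →L[ℝ] Euc n) (ω : ℝ → Euc n) : Euc n :=
  ∫ s in Iic (0 : ℝ), A (NormedSpace.exp ((-s) • A) (ω s))

/-- Joint measurability serves twice: in t it makes the forcing integrable, in ω it makes the random
field measurable. -/
theorem measurable_ouIntegral_shift (A : Euc n →L[ℝ] Euc n) :
    Measurable fun p : PathSpace n × ℝ => ouIntegral A (shift p.2 p.1).1 := by
  have hm : Measurable fun q : (PathSpace n × ℝ) × ℝ =>
      A (NormedSpace.exp ((-q.2) • A) ((shift q.1.2 q.1.1).1 q.2)) := by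
    refine A.continuous.measurable.comp ?_
    have h1 : Measurable fun q : (PathSpace n × ℝ) × ℝ => q.1.1.1 (q.2 + q.1.2) - q.1.1.1 q.1.2 :=
      (measurable_path_uncurry.comp (measurable_fst.fst.prodMk
        (measurable_snd.add measurable_fst.snd))).sub
        (measurable_path_uncurry.comp measurable_fst)
    exact (isBoundedBilinearMap_apply (𝕜 := ℝ) (E := Euc n) (F := Euc n)).continuous.measurable.comp
      ((((continuous_exp_smul A).comp continuous_neg).measurable.comp measurable_snd).prodMk h1)
  exact (hm.stronglyMeasurable.integral_prod_right (ν := volume.restrict (Iic 0))).measurable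

section Dissipative

variable {A : Euc n →L[ℝ] Euc n} {lam c C : ℝ}

theorem norm_ou_integrand_le
    (hA : ∀ t : ℝ, 0 ≤ t → ∀ y, ‖NormedSpace.exp (t • A) y‖ ≤ Real.exp (-(lam * t)) * ‖y‖)
    {ω : ℝ → Euc n} (hω : GrowthBound C c ω) {s : ℝ} (hs : s ≤ 0) :
    ‖A (NormedSpace.exp ((-s) • A) (ω s))‖ ≤ ‖A‖ * C * Real.exp ((lam - c) * s) := by
  have h := hA (-s) (by linarith) (ω s)
  calc _ ≤ ‖A‖ * ‖NormedSpace.exp ((-s) • A) (ω s)‖ := A.le_opNorm _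
    _ ≤ ‖A‖ * (Real.exp (-(lam * -s)) * (C * Real.exp (-(c * s)))) := by
        gcongr
        exact h.trans (by gcongr; exact hω s hs)
    _ = ‖A‖ * C * Real.exp ((lam - c) * s) := by
        rw [show (lam - c) * s = -(lam * -s) + -(c * s) by ring, Real.exp_add]
        ring

theorem integrableOn_ou_integrand
    (hA : ∀ t : ℝ, 0 ≤ t → ∀ y, ‖NormedSpace.exp (t • A) y‖ ≤ Real.exp (-(lam * t)) * ‖y‖)
    (hc : c < lam) {ω : PathSpace n} (hω : GrowthBound C c ω.1) :
    IntegrableOn (fun s => A (NormedSpace.exp ((-s) • A) (ω.1 s))) (Iic 0) := by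
  refine Integrable.mono' ((integrableOn_exp_mul_Iic (sub_pos.2 hc) 0).const_mul (‖A‖ * C)) ?_ ?_
  · refine Measurable.aestronglyMeasurable (A.continuous.measurable.comp ?_)
    exact (isBoundedBilinearMap_apply (𝕜 := ℝ) (E := Euc n) (F := Euc n)).continuous.measurable.comp
      ((((continuous_exp_smul A).comp continuous_neg).measurable).prodMk (measurable_path ω))
  · exact (ae_restrict_mem measurableSet_Iic).mono fun s hs => norm_ou_integrand_le hA hω hs

theorem norm_ouIntegral_le
    (hA : ∀ t : ℝ, 0 ≤ t → ∀ y, ‖NormedSpace.exp (t • A) y‖ ≤ Real.exp (-(lam * t)) * ‖y‖)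
    (hc : c < lam) {ω : ℝ → Euc n} (hω : GrowthBound C c ω) :
    ‖ouIntegral A ω‖ ≤ ‖A‖ * C / (lam - c) := by
  refine (norm_integral_le_of_norm_le
    ((integrableOn_exp_mul_Iic (sub_pos.2 hc) 0).const_mul (‖A‖ * C))
    ((ae_restrict_mem measurableSet_Iic).mono fun s hs => norm_ou_integrand_le hA hω hs)).trans ?_
  rw [integral_const_mul, integral_exp_mul_Iic (sub_pos.2 hc)]
  simp [div_eq_mul_inv]

/-- Integration by parts on [u, 0]: the boundary term at 0 vanishes since ω(0) = 0, and the one at u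
vanishes as u → -∞ since the semigroup decays faster than the path grows (c < lam). -/
theorem hasStieltjesIntegralIic_exp
    (hA : ∀ t : ℝ, 0 ≤ t → ∀ y, ‖NormedSpace.exp (t • A) y‖ ≤ Real.exp (-(lam * t)) * ‖y‖)
    (hc : c < lam) {ω : PathSpace n} (hω : GrowthBound C c ω.1) :
    HasStieltjesIntegralIic (fun s => NormedSpace.exp ((-s) • A)) ω.1 (ouIntegral A ω.1) := by
  have hd : ∀ s : ℝ, HasDerivAt (fun s : ℝ => NormedSpace.exp ((-s) • A))
      (-(A * NormedSpace.exp ((-s) • A))) s := by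
    intro s
    have h := (hasDerivAt_exp_smul_const' (𝕂 := ℝ) A (-s)).scomp s (hasDerivAt_neg s)
    rw [neg_one_smul] at h
    exact h
  have hcont : Continuous fun s : ℝ => -(A * NormedSpace.exp ((-s) • A)) :=
    (continuous_const.mul ((continuous_exp_smul A).comp continuous_neg)).neg
  refine ⟨_, fun u hu => hasStieltjesIntegral_of_hasDerivAt hd hcont ω hu, ?_⟩
  have h1 : Tendsto (fun u : ℝ => NormedSpace.exp ((-u) • A) (ω.1 u)) atBot (𝓝 0) := by
    refine squeeze_zero_norm' (a := fun u => C * Real.exp ((lam - c) * u)) ?_ ?_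
    · filter_upwards [Iic_mem_atBot 0] with u hu
      refine (hA (-u) (by linarith [mem_Iic.1 hu]) _).trans ?_
      rw [show (lam - c) * u = -(lam * -u) + -(c * u) by ring, Real.exp_add]
      have := mul_le_mul_of_nonneg_left (hω u hu) (Real.exp_pos (-(lam * -u))).le
      linarith
    · have : Tendsto (fun u : ℝ => (lam - c) * u) atBot atBot :=
        tendsto_id.const_mul_atBot (sub_pos.2 hc)
      simpa using (Real.tendsto_exp_atBot.comp this).const_mul C
  have h2 := intervalIntegral_tendsto_integral_Iic 0 (integrableOn_ou_integrand hA hc hω) tendsto_id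
  have h3 := (h1.neg).add h2
  simp only [neg_zero, zero_add] at h3
  refine h3.congr fun u => ?_
  simp [ω.2.2, intervalIntegral.integral_neg, sub_eq_add_neg]

end Dissipative

end

section

/-! ### Variation of constants -/

section Duhamel

variable {E : Type*} [NormedAddCommGroup E] [NormedSpace ℝ E]

theorem continuousOn_primitive_Iic {h : ℝ → E} (hh : ∀ t ≤ 0, IntervalIntegrable h volume 0 t) :
    ContinuousOn (fun t => ∫ s in (0 : ℝ)..t, h s) (Iic 0) := by
  intro t ht
  have ht' : t - 1 ≤ 0 := by linarith [mem_Iic.1 ht]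
  have h1 : ContinuousOn (fun t => ∫ s in (0 : ℝ)..t, h s) (uIcc 0 (t - 1)) :=
    intervalIntegral.continuousOn_primitive_interval' (hh (t - 1) ht') left_mem_uIcc
  rw [uIcc_of_ge ht'] at h1
  refine (h1 t ⟨by linarith, ht⟩).mono_of_mem_nhdsWithin ?_
  filter_upwards [self_mem_nhdsWithin,
    mem_nhdsWithin_of_mem_nhds (Ioi_mem_nhds (sub_one_lt t))] with s hs hs'
  exact ⟨le_of_lt hs', hs⟩

theorem IntervalIntegrable.clm_apply {Ψ : ℝ → E →L[ℝ] E} (hΨ : Continuous Ψ) {h : ℝ → E} {a b : ℝ}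
    (hh : IntervalIntegrable h volume a b) :
    IntervalIntegrable (fun s => Ψ s (h s)) volume a b := by
  obtain ⟨M, hM⟩ := (isCompact_uIcc (a := a) (b := b)).exists_bound_of_continuousOn
    hΨ.continuousOn
  rw [intervalIntegrable_iff] at hh ⊢
  refine (hh.norm.const_mul M).mono' ?_ ?_
  · exact (isBoundedBilinearMap_apply (𝕜 := ℝ) (E := E)
      (F := E)).continuous.comp_aestronglyMeasurable
      (hΨ.aestronglyMeasurable.prodMk hh.aestronglyMeasurable)
  · refine (ae_restrict_mem measurableSet_uIoc).mono fun s hs => ?_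
    exact (ContinuousLinearMap.le_opNorm _ _).trans
      (mul_le_mul_of_nonneg_right (hM s (uIoc_subset_uIcc hs)) (norm_nonneg _))

variable [CompleteSpace E]

/-- Fubini on the triangle s < r. This is integration by parts for an h that is only integrable, as
is the case here because the forcing is not assumed continuous. -/
theorem integral_deriv_apply_primitive {Φ Φ' : ℝ → E →L[ℝ] E}
    (hΦ : ∀ s, HasDerivAt Φ (Φ' s) s) (hΦ' : Continuous Φ') {h : ℝ → E} {a b : ℝ} (hab : a ≤ b)
    (hh : IntervalIntegrable h volume a b) :
    ∫ s in a..b, Φ' s (∫ r in s..b, h r) = ∫ r in a..b, (Φ r - Φ a) (h r) := by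
  have hhI : IntegrableOn h (Ioc a b) := (intervalIntegrable_iff_integrableOn_Ioc_of_le hab).1 hh
  obtain ⟨M, hM⟩ := (isCompact_Icc (a := a) (b := b)).exists_bound_of_continuousOn
    hΦ'.continuousOn
  let μ : Measure ℝ := volume.restrict (Ioc a b)
  let G : ℝ → ℝ → E := fun s r => indicator {p : ℝ × ℝ | p.1 < p.2} (fun p => Φ' p.1 (h p.2)) (s, r)
  have hlt : MeasurableSet {p : ℝ × ℝ | p.1 < p.2} := measurableSet_lt measurable_fst measurable_snd
  have hmeas : AEStronglyMeasurable (fun p : ℝ × ℝ => Φ' p.1 (h p.2)) (μ.prod μ) := by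
    have h1 : AEStronglyMeasurable (fun p : ℝ × ℝ => h p.2) (μ.prod μ) :=
      hhI.aestronglyMeasurable.comp_snd
    have h2 : AEStronglyMeasurable (fun p : ℝ × ℝ => Φ' p.1) (μ.prod μ) :=
      hΦ'.aestronglyMeasurable.comp_fst
    exact (isBoundedBilinearMap_apply (𝕜 := ℝ) (E := E) (F := E)).continuous.comp_aestronglyMeasurable
      (h2.prodMk h1)
  have hG : Integrable (Function.uncurry G) (μ.prod μ) := by
    have hb : Integrable (fun p : ℝ × ℝ => M * ‖h p.2‖) (μ.prod μ) :=
      Integrable.mul_prod (f := fun _ : ℝ => M) (integrable_const M) hhI.norm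
    refine hb.mono' (hmeas.indicator hlt) ?_
    have hae : ∀ᵐ p : ℝ × ℝ ∂(μ.prod μ), p.1 ∈ Ioc a b :=
      Measure.quasiMeasurePreserving_fst.ae (ae_restrict_mem measurableSet_Ioc)
    filter_upwards [hae] with p hp
    exact (norm_indicator_le_norm_self (fun p : ℝ × ℝ => Φ' p.1 (h p.2)) p).trans
      ((ContinuousLinearMap.le_opNorm _ _).trans
        (mul_le_mul_of_nonneg_right (hM _ (Ioc_subset_Icc_self hp)) (norm_nonneg _)))
  have hswap := integral_integral_swap hG
  have e1 : ∀ s ∈ Ioc a b, ∫ r, G s r ∂μ = Φ' s (∫ r in s..b, h r) := by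
    intro s hs
    have : ∀ r, G s r = indicator (Ioi s) (fun r => Φ' s (h r)) r := fun r => by
      simp only [G, indicator_apply, mem_ofPred_eq, mem_Ioi]
    simp_rw [this]
    rw [integral_indicator measurableSet_Ioi, Measure.restrict_restrict measurableSet_Ioi,
      show Ioi s ∩ Ioc a b = Ioc s b by
        ext r; simp only [mem_inter_iff, mem_Ioi, mem_Ioc]
        exact ⟨fun h => ⟨h.1, h.2.2⟩, fun h => ⟨h.1, hs.1.trans h.1, h.2⟩⟩,
      intervalIntegral.integral_of_le hs.2]
    exact ContinuousLinearMap.integral_comp_comm _ (hhI.mono_set (Ioc_subset_Ioc_left hs.1.le))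
  have e2 : ∀ r ∈ Ioc a b, ∫ s, G s r ∂μ = (Φ r - Φ a) (h r) := by
    intro r hr
    have : ∀ s, G s r = indicator (Iio r) (fun s => Φ' s (h r)) s := fun s => by
      simp only [G, indicator_apply, mem_ofPred_eq, mem_Iio]
    simp_rw [this]
    rw [integral_indicator measurableSet_Iio, Measure.restrict_restrict measurableSet_Iio,
      show Iio r ∩ Ioc a b = Ioo a r by
        ext s; simp only [mem_inter_iff, mem_Iio, mem_Ioc, mem_Ioo]
        exact ⟨fun h => ⟨h.2.1, h.1⟩, fun h => ⟨h.2, h.1, h.2.le.trans hr.2⟩⟩,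
      ← integral_Ioc_eq_integral_Ioo, ← intervalIntegral.integral_of_le hr.1.le]
    exact intervalIntegral.integral_eq_sub_of_hasDerivAt
      (fun s _ => by simpa using (hΦ s).clm_apply (hasDerivAt_const s (h r)))
      ((hΦ'.clm_apply continuous_const).intervalIntegrable _ _)
  rw [intervalIntegral.integral_of_le hab, intervalIntegral.integral_of_le hab,
    ← setIntegral_congr_fun measurableSet_Ioc e1, ← setIntegral_congr_fun measurableSet_Ioc e2]
  exact hswap

/-- Integration by parts for a primitive `H`. -/
theorem clm_apply_primitive_eq {Φ Φ' : ℝ → E →L[ℝ] E}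
    (hΦ : ∀ s, HasDerivAt Φ (Φ' s) s) (hΦ' : Continuous Φ') {h H : ℝ → E} {x₀ : E}
    (hh : ∀ t ≤ 0, IntervalIntegrable h volume 0 t)
    (hH : ∀ t ≤ 0, H t = x₀ + ∫ s in (0 : ℝ)..t, h s) {t : ℝ} (ht : t ≤ 0) :
    Φ t (H t) = Φ 0 x₀ + ∫ s in (0 : ℝ)..t, (Φ' s (H s) + Φ s (h s)) := by
  have hHc : ContinuousOn H (Iic 0) :=
    (continuousOn_const.add (continuousOn_primitive_Iic hh)).congr hH
  have hsub : uIcc t 0 ⊆ Iic 0 := by rw [uIcc_of_le ht]; exact fun s hs => hs.2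
  have hΦc : Continuous Φ := continuous_iff_continuousAt.2 fun s => (hΦ s).continuousAt
  have hht : IntervalIntegrable h volume t 0 := (hh t ht).symm
  have i1 : IntervalIntegrable (fun s => Φ' s (H s)) volume t 0 :=
    (hΦ'.continuousOn.clm_apply (hHc.mono hsub)).intervalIntegrable
  have i2 := IntervalIntegrable.clm_apply hΦc hht
  have i3 : IntervalIntegrable (fun s => Φ' s x₀) volume t 0 :=
    (hΦ'.clm_apply continuous_const).intervalIntegrable _ _
  -- The primitive taken from s up to 0 is x₀ - H(s), which brings H into the Fubini identity.
  have e1 : ∀ s ∈ uIcc t 0, Φ' s (∫ r in s..0, h r) = Φ' s x₀ - Φ' s (H s) := by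
    intro s hs
    rw [← map_sub, hH s (hsub hs), intervalIntegral.integral_symm]
    simp
  have key := integral_deriv_apply_primitive hΦ hΦ' ht hht
  rw [intervalIntegral.integral_congr e1, intervalIntegral.integral_sub i3 i1] at key
  simp only [sub_apply] at key
  rw [intervalIntegral.integral_sub i2 (IntervalIntegrable.clm_apply (continuous_const (y := Φ t)) hht),
    (Φ t).intervalIntegral_comp_comm hht,
    intervalIntegral.integral_eq_sub_of_hasDerivAt
      (fun s _ => by simpa using (hΦ s).clm_apply (hasDerivAt_const s x₀)) i3] at key
  rw [intervalIntegral.integral_symm, intervalIntegral.integral_add i1 i2, hH t ht,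
    intervalIntegral.integral_symm t 0, map_add, map_neg, ← sub_eq_zero]
  rw [← sub_eq_zero] at key
  rw [← neg_eq_zero, ← key]
  abel

/-- The factorisation e^{aA(t-s)} = e^{aAt} e^{-aAs} takes t out of the integrand, so that
convolutions become an operator applied to a primitive. -/
theorem exp_smul_primitive_eq (a : ℝ) (A : E →L[ℝ] E) {f : ℝ → E} (x₀ : E) {t : ℝ}
    (hf : IntervalIntegrable f volume 0 t) :
    NormedSpace.exp ((a * t) • A)
        (x₀ + ∫ s in (0 : ℝ)..t, a • NormedSpace.exp ((-(a * s)) • A) (f s)) =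
      NormedSpace.exp ((a * t) • A) x₀ +
        a • ∫ s in (0 : ℝ)..t, NormedSpace.exp ((a * (t - s)) • A) (f s) := by
  have hi : IntervalIntegrable (fun s => NormedSpace.exp ((-(a * s)) • A) (f s)) volume 0 t :=
    IntervalIntegrable.clm_apply (Ψ := fun s => NormedSpace.exp ((-(a * s)) • A))
      ((continuous_exp_smul A).comp (by fun_prop)) hf
  rw [map_add, intervalIntegral.integral_smul, map_smul,
    ← ContinuousLinearMap.intervalIntegral_comp_comm _ hi]
  congr 3
  ext s
  rw [← exp_add_smul]
  congr 3
  ring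

theorem continuousOn_duhamel (a : ℝ) (A : E →L[ℝ] E) {f : ℝ → E} (x₀ : E)
    (hf : ∀ t ≤ 0, IntervalIntegrable f volume 0 t) :
    ContinuousOn (fun t => NormedSpace.exp ((a * t) • A) x₀ +
        a • ∫ s in (0 : ℝ)..t, NormedSpace.exp ((a * (t - s)) • A) (f s)) (Iic 0) := by
  have h1 : ContinuousOn (fun t : ℝ => NormedSpace.exp ((a * t) • A)
      (x₀ + ∫ s in (0 : ℝ)..t, a • NormedSpace.exp ((-(a * s)) • A) (f s))) (Iic 0) := by
    refine ContinuousOn.clm_apply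
      ((continuous_exp_smul A).comp (by fun_prop : Continuous fun t : ℝ => a * t)).continuousOn
      (continuousOn_const.add (continuousOn_primitive_Iic fun t ht => ?_))
    exact (IntervalIntegrable.clm_apply (Ψ := fun s => NormedSpace.exp ((-(a * s)) • A))
      ((continuous_exp_smul A).comp (by fun_prop)) (hf t ht)).smul a
  exact h1.congr fun t ht => (exp_smul_primitive_eq a A x₀ (hf t ht)).symm

/-- Variation of constants, for an integrable inhomogeneity. -/
theorem eq_duhamel_iff (a : ℝ) (A : E →L[ℝ] E) {f x : ℝ → E} (x₀ : E)
    (hf : ∀ t ≤ 0, IntervalIntegrable f volume 0 t) (hx : ContinuousOn x (Iic 0)) :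
    (∀ t ≤ 0, x t = x₀ + a • ∫ s in (0 : ℝ)..t, (A (x s) + f s)) ↔
      ∀ t ≤ 0, x t = NormedSpace.exp ((a * t) • A) x₀ +
        a • ∫ s in (0 : ℝ)..t, NormedSpace.exp ((a * (t - s)) • A) (f s) := by
  have hd : ∀ (c s : ℝ), HasDerivAt (fun s : ℝ => NormedSpace.exp ((c * s) • A))
      (c • (NormedSpace.exp ((c * s) • A) * A)) s := fun c s =>
    (hasDerivAt_exp_smul_const (𝕂 := ℝ) A (c * s)).scomp s
      (by simpa using (hasDerivAt_id s).const_mul c)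
  have hcont : ∀ c : ℝ, Continuous fun s : ℝ => NormedSpace.exp ((c * s) • A) := fun c =>
    (continuous_exp_smul A).comp (by fun_prop)
  have hcont' : ∀ c : ℝ, Continuous fun s : ℝ => c • (NormedSpace.exp ((c * s) • A) * A) :=
    fun c => ((hcont c).mul continuous_const).const_smul c
  have hcomm : ∀ (r : ℝ) (v : E), NormedSpace.exp (r • A) (A v) = A (NormedSpace.exp (r • A) v) := by
    intro r v
    exact congrArg (fun B : E →L[ℝ] E => B v)
      ((((Commute.refl A).smul_right r).exp_right).eq.symm : NormedSpace.exp (r • A) * A = A * _)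
  constructor
  · intro h t ht
    have hAx : ∀ t ≤ 0, IntervalIntegrable (fun s => A (x s)) volume 0 t := fun t ht =>
      (A.continuous.comp_continuousOn (hx.mono (by
        rw [uIcc_of_ge ht]; exact fun s hs => hs.2))).intervalIntegrable
    have hH : ∀ t ≤ 0, x t = x₀ + ∫ s in (0 : ℝ)..t, a • (A (x s) + f s) := fun t ht => by
      rw [h t ht, intervalIntegral.integral_smul]
    -- Conjugation by e^{-asA}: the terms containing A(x(s)) cancel, and only a e^{-asA} f(s) is
    -- left to integrate.
    have key := clm_apply_primitive_eq (h := fun s => a • (A (x s) + f s)) (hd (-a)) (hcont' (-a))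
      (fun t ht => ((hAx t ht).add (hf t ht)).smul a) hH ht
    have hs : ∀ s, ((-a) • (NormedSpace.exp ((-a * s) • A) * A)) (x s) +
        NormedSpace.exp ((-a * s) • A) (a • (A (x s) + f s)) =
        a • NormedSpace.exp ((-(a * s)) • A) (f s) := by
      intro s
      rw [smul_apply, mul_apply_eq_comp, map_smul, map_add, neg_mul]
      module
    simp_rw [hs] at key
    rw [mul_zero, zero_smul, NormedSpace.exp_zero, one_apply_eq_self] at key
    rw [← exp_smul_primitive_eq a A x₀ (hf t ht), ← key, neg_mul, exp_smul_neg_apply]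
  · intro h t ht
    -- Conversely, e^{asA} is applied to the primitive of a e^{-asA} f(s); the product rule returns
    -- the differential form.
    have key := clm_apply_primitive_eq (H := fun t => x₀ +
        ∫ s in (0 : ℝ)..t, a • NormedSpace.exp ((-(a * s)) • A) (f s))
      (h := fun s => a • NormedSpace.exp ((-(a * s)) • A) (f s)) (hd a)
      (hcont' a)
      (fun t ht => (IntervalIntegrable.clm_apply (Ψ := fun s => NormedSpace.exp ((-(a * s)) • A))
        ((continuous_exp_smul A).comp (by fun_prop)) (hf t ht)).smul a) (fun _ _ => rfl) ht
    rw [exp_smul_primitive_eq a A x₀ (hf t ht), ← h t ht, mul_zero, zero_smul,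
      NormedSpace.exp_zero, one_apply_eq_self] at key
    rw [key, ← intervalIntegral.integral_smul]
    congr 1
    refine intervalIntegral.integral_congr fun s hs => ?_
    have hs' : s ≤ 0 := by rw [uIcc_of_ge ht] at hs; exact hs.2
    simp only [smul_apply, mul_apply_eq_comp, map_smul, exp_smul_neg_apply]
    rw [hcomm, exp_smul_primitive_eq a A x₀ (hf s hs'), ← h s hs', smul_add]

end Duhamel

end

section

/-! ### Exponentially weighted convolution estimates -/

section Weighted

variable {E : Type*} [NormedAddCommGroup E]

/-- `u` is measurable on `(-∞, 0]`, with `|u(t)| ≤ C e^{βt}` there. -/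
structure WeightedBound (C β : ℝ) (u : ℝ → E) : Prop where
  meas : AEStronglyMeasurable u (volume.restrict (Iic 0))
  bound : ∀ t ≤ 0, ‖u t‖ ≤ C * Real.exp (β * t)

theorem WeightedBound.intervalIntegrable {C β : ℝ} {u : ℝ → E} (h : WeightedBound C β u) {t : ℝ}
    (ht : t ≤ 0) : IntervalIntegrable u volume 0 t := by
  have hc : Continuous fun s : ℝ => C * Real.exp (β * s) := by fun_prop
  have hs : uIoc 0 t ⊆ Iic 0 := by rw [uIoc_of_ge ht]; exact fun s hs => hs.2
  have hi := hc.intervalIntegrable (μ := volume) 0 t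
  rw [intervalIntegrable_iff] at hi ⊢
  exact hi.mono' (h.meas.mono_set hs)
    ((ae_restrict_mem measurableSet_uIoc).mono fun s hs' => h.bound s (hs hs'))

variable [NormedSpace ℝ E]

theorem inWeighted_iff {n : ℕ} {β : ℝ} {φ : ℝ → Euc n} :
    InWeighted β φ ↔ ContinuousOn φ (Iic 0) ∧ ∃ C, WeightedBound C β φ := by
  have key : ∀ (C t : ℝ), ‖Real.exp (-β * t) • φ t‖ ≤ C ↔ ‖φ t‖ ≤ C * Real.exp (β * t) := by
    intro C t
    rw [norm_smul, Real.norm_of_nonneg (Real.exp_pos _).le, neg_mul, Real.exp_neg,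
      inv_mul_le_iff₀ (Real.exp_pos _), mul_comm]
  constructor
  · rintro ⟨hc, C, hC⟩
    exact ⟨hc, C, hc.aestronglyMeasurable measurableSet_Iic, fun t ht => (key C t).1 (hC t ht)⟩
  · rintro ⟨hc, C, hC⟩
    exact ⟨hc, C, fun t ht => (key C t).2 (hC.bound t ht)⟩

variable {A : E →L[ℝ] E} {g a β B : ℝ} {u : ℝ → E}

/-- The integrand is at most a multiple of e^{(β-ag)s} with a negative exponent rate, so enlarging
(t, 0] to (t, ∞) costs nothing essential and leaves a pure multiple of e^{βt}. -/
theorem WeightedBound.norm_slow_convolution_le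
    (hA : ∀ t : ℝ, t ≤ 0 → ∀ x, ‖NormedSpace.exp (t • A) x‖ ≤ Real.exp (g * t) * ‖x‖)
    (ha : 0 < a) (hβ : β < a * g) (hu : WeightedBound B β u) {t : ℝ} (ht : t ≤ 0) :
    ‖a • ∫ s in (0 : ℝ)..t, NormedSpace.exp ((a * (t - s)) • A) (u s)‖ ≤
      a * B / (a * g - β) * Real.exp (β * t) := by
  have hB : 0 ≤ B := by simpa using (norm_nonneg _).trans (hu.bound 0 le_rfl)
  have hneg : β - a * g < 0 := by linarith
  have hI := integrableOn_exp_mul_Ioi hneg t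
  have hb : ‖∫ s in (0 : ℝ)..t, NormedSpace.exp ((a * (t - s)) • A) (u s)‖ ≤
      ∫ s in Ioi t, B * Real.exp (a * g * t) * Real.exp ((β - a * g) * s) := by
    rw [intervalIntegral.integral_symm, norm_neg, intervalIntegral.integral_of_le ht]
    refine (norm_integral_le_of_norm_le ((hI.mono_set Ioc_subset_Ioi_self).const_mul
      (B * Real.exp (a * g * t))) ?_).trans (setIntegral_mono_set (hI.const_mul _)
        (Eventually.of_forall fun s => by simp only [Pi.zero_apply]; positivity)
        (LE.le.eventuallyLE Ioc_subset_Ioi_self))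
    refine (ae_restrict_mem measurableSet_Ioc).mono fun s hs => ?_
    refine (hA _ (mul_nonpos_of_nonneg_of_nonpos ha.le (by linarith [hs.1])) _).trans ?_
    refine (mul_le_mul_of_nonneg_left (hu.bound s hs.2) (Real.exp_pos _).le).trans (le_of_eq ?_)
    rw [show g * (a * (t - s)) = a * g * t - a * g * s by ring,
      show (β - a * g) * s = β * s - a * g * s by ring, Real.exp_sub, Real.exp_sub]
    ring
  rw [integral_const_mul, integral_exp_mul_Ioi hneg] at hb
  rw [norm_smul, Real.norm_of_nonneg ha.le]
  refine (mul_le_mul_of_nonneg_left hb ha.le).trans (le_of_eq ?_)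
  rw [show (β - a * g) * t = β * t - a * g * t by ring, Real.exp_sub]
  have h1 : β - a * g ≠ 0 := hneg.ne
  have h2 : a * g - β ≠ 0 := by linarith
  have := (Real.exp_pos (a * g * t)).ne'
  rw [show a * g - β = -(β - a * g) by ring]
  field_simp

theorem WeightedBound.norm_fast_integrand_le
    (hA : ∀ t : ℝ, 0 ≤ t → ∀ x, ‖NormedSpace.exp (t • A) x‖ ≤ Real.exp (g * t) * ‖x‖)
    (ha : 0 < a) (hu : WeightedBound B β u) {s t : ℝ} (ht : t ≤ 0) (hs : s ≤ t) :
    ‖NormedSpace.exp ((a * (t - s)) • A) (u s)‖ ≤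
      B * Real.exp (a * g * t) * Real.exp ((β - a * g) * s) := by
  refine (hA _ (mul_nonneg ha.le (by linarith)) _).trans ?_
  refine (mul_le_mul_of_nonneg_left (hu.bound s (hs.trans ht)) (Real.exp_pos _).le).trans
    (le_of_eq ?_)
  rw [show g * (a * (t - s)) = a * g * t - a * g * s by ring,
    show (β - a * g) * s = β * s - a * g * s by ring, Real.exp_sub, Real.exp_sub]
  ring

/-- The gap ag < β makes the majorant e^{(β-ag)s} integrable at -∞; its integral up to t produces
the denominator β - ag. -/
theorem WeightedBound.norm_fast_convolution_le
    (hA : ∀ t : ℝ, 0 ≤ t → ∀ x, ‖NormedSpace.exp (t • A) x‖ ≤ Real.exp (g * t) * ‖x‖)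
    (ha : 0 < a) (hβ : a * g < β) (hu : WeightedBound B β u) {t : ℝ} (ht : t ≤ 0) :
    ‖a • ∫ s in Iic t, NormedSpace.exp ((a * (t - s)) • A) (u s)‖ ≤
      a * B / (β - a * g) * Real.exp (β * t) := by
  have hb := norm_integral_le_of_norm_le ((integrableOn_exp_mul_Iic (sub_pos.2 hβ) t).const_mul
    (B * Real.exp (a * g * t))) ((ae_restrict_mem measurableSet_Iic).mono fun s hs =>
      hu.norm_fast_integrand_le hA ha ht hs)
  rw [integral_const_mul, integral_exp_mul_Iic (sub_pos.2 hβ)] at hb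
  rw [norm_smul, Real.norm_of_nonneg ha.le]
  refine (mul_le_mul_of_nonneg_left hb ha.le).trans (le_of_eq ?_)
  rw [show (β - a * g) * t = β * t - a * g * t by ring, Real.exp_sub]
  have h1 : β - a * g ≠ 0 := (sub_pos.2 hβ).ne'
  have := (Real.exp_pos (a * g * t)).ne'
  field_simp

variable [CompleteSpace E]

theorem WeightedBound.integrableOn_fast
    (hA : ∀ t : ℝ, 0 ≤ t → ∀ x, ‖NormedSpace.exp (t • A) x‖ ≤ Real.exp (g * t) * ‖x‖)
    (ha : 0 < a) (hβ : a * g < β) (hu : WeightedBound B β u) {t : ℝ} (ht : t ≤ 0) :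
    IntegrableOn (fun s => NormedSpace.exp ((a * (t - s)) • A) (u s)) (Iic t) := by
  refine ((integrableOn_exp_mul_Iic (sub_pos.2 hβ) t).const_mul
    (B * Real.exp (a * g * t))).mono' ?_ ?_
  · exact (isBoundedBilinearMap_apply (𝕜 := ℝ) (E := E)
      (F := E)).continuous.comp_aestronglyMeasurable
      (((continuous_exp_smul A).comp
        (by fun_prop : Continuous fun s : ℝ => a * (t - s))).aestronglyMeasurable.prodMk
        (hu.meas.mono_set (Iic_subset_Iic.2 ht)))
  · exact (ae_restrict_mem measurableSet_Iic).mono fun s hs =>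
      hu.norm_fast_integrand_le hA ha ht hs

theorem WeightedBound.intervalIntegrable_convolution (hu : WeightedBound B β u) {t : ℝ}
    (ht : t ≤ 0) :
    IntervalIntegrable (fun s => NormedSpace.exp ((a * (t - s)) • A) (u s)) volume 0 t :=
  IntervalIntegrable.clm_apply (Ψ := fun s => NormedSpace.exp ((a * (t - s)) • A))
    ((continuous_exp_smul A).comp (by fun_prop)) (hu.intervalIntegrable ht)

/-- The fast convolution is the solution of the linear equation that starts from its own value
at time `0`. -/
theorem WeightedBound.fast_convolution_eq
    (hA : ∀ t : ℝ, 0 ≤ t → ∀ x, ‖NormedSpace.exp (t • A) x‖ ≤ Real.exp (g * t) * ‖x‖)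
    (ha : 0 < a) (hβ : a * g < β) (hu : WeightedBound B β u) {t : ℝ} (ht : t ≤ 0) :
    a • ∫ s in Iic t, NormedSpace.exp ((a * (t - s)) • A) (u s) =
      NormedSpace.exp ((a * t) • A)
        (a • ∫ s in Iic (0 : ℝ), NormedSpace.exp ((-(a * s)) • A) (u s)) +
      a • ∫ s in (0 : ℝ)..t, NormedSpace.exp ((a * (t - s)) • A) (u s) := by
  have hI : IntegrableOn (fun s => NormedSpace.exp ((-(a * s)) • A) (u s)) (Iic 0) := by
    simpa using hu.integrableOn_fast hA ha hβ (le_refl (0 : ℝ))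
  have hexp : ∀ s, NormedSpace.exp ((a * (t - s)) • A) (u s) =
      NormedSpace.exp ((a * t) • A) (NormedSpace.exp ((-(a * s)) • A) (u s)) := fun s => by
    rw [← exp_add_smul]
    congr 3
    ring
  have hIt := hI.mono_set (Iic_subset_Iic.2 ht)
  have hint : IntervalIntegrable (fun s => NormedSpace.exp ((-(a * s)) • A) (u s)) volume 0 t := by
    rw [intervalIntegrable_iff, uIoc_of_ge ht]
    exact hI.mono_set fun s hs => hs.2
  simp_rw [hexp]
  rw [ContinuousLinearMap.integral_comp_comm _ hIt,
    ContinuousLinearMap.intervalIntegral_comp_comm _ hint, map_smul, ← smul_add, ← map_add,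
    ← intervalIntegral.integral_Iic_sub_Iic hI hIt, add_sub_cancel]

end Weighted

end

section

variable {n₁ n₂ : ℕ}

/-! ### The Lyapunov–Perron operator and its iterates -/

/-- The slow component of the Lyapunov–Perron operator. -/
def System.slowMap (D : System n₁ n₂) (a : ℝ) (z : ℝ → Euc n₂) (x₀ : Euc n₁)
    (x : ℝ → Euc n₁) (y : ℝ → Euc n₂) (t : ℝ) : Euc n₁ :=
  NormedSpace.exp ((a * t) • D.S) x₀ +
    a • ∫ s in (0 : ℝ)..t, NormedSpace.exp ((a * (t - s)) • D.S) (D.g₁ (x s) (y s + D.σ • z s))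

/-- The fast component of the Lyapunov–Perron operator. -/
def System.fastMap (D : System n₁ n₂) (b : ℝ) (z : ℝ → Euc n₂)
    (x : ℝ → Euc n₁) (y : ℝ → Euc n₂) (t : ℝ) : Euc n₂ :=
  b • ∫ s in Iic t, NormedSpace.exp ((b * (t - s)) • D.F) (D.g₂ (x s) (y s + D.σ • z s))

/-- The iterates of the Lyapunov–Perron operator, started from `0`. -/
def System.picard (D : System n₁ n₂) (a b : ℝ) (z : ℝ → Euc n₂) (x₀ : Euc n₁) :
    ℕ → (ℝ → Euc n₁) × (ℝ → Euc n₂)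
  | 0 => (fun _ => 0, fun _ => 0)
  | k + 1 => (D.slowMap a z x₀ (D.picard a b z x₀ k).1 (D.picard a b z x₀ k).2,
      D.fastMap b z (D.picard a b z x₀ k).1 (D.picard a b z x₀ k).2)

/-- The hypotheses under which the Lyapunov–Perron operator is a contraction of `C_β⁻`. -/
structure System.IsContractive (D : System n₁ n₂) (a b β K γs γf : ℝ) (z : ℝ → Euc n₂) :
    Prop where
  linearBounds : D.LinearBounds γs γf
  lipschitz : D.LipschitzNonlinearities K
  K_nonneg : 0 ≤ K
  γs_pos : 0 < γs
  a_pos : 0 < a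
  b_pos : 0 < b
  β_neg : β < 0
  gap : b * γf < β
  contraction : a * K / (a * γs - β) + b * K / (β - b * γf) < 1
  forcing : ∃ C, WeightedBound C β z

/-! ### Superposition operators on exponentially weighted functions -/

section Nemytskii

variable {E₁ E₂ E₃ : Type*} [NormedAddCommGroup E₁] [NormedAddCommGroup E₂] [NormedAddCommGroup E₃]
  {g : E₁ → E₂ → E₃} {K : ℝ}

theorem continuous_of_lipschitz_add
    (hg : ∀ x x' y y', ‖g x y - g x' y'‖ ≤ K * (‖x - x'‖ + ‖y - y'‖)) :
    Continuous (Function.uncurry g) := by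
  rw [continuous_iff_continuousAt]
  rintro ⟨x, y⟩
  rw [ContinuousAt, tendsto_iff_norm_sub_tendsto_zero]
  refine squeeze_zero (fun _ => norm_nonneg _) (fun p => hg p.1 x p.2 y) ?_
  have : Continuous fun p : E₁ × E₂ => K * (‖p.1 - x‖ + ‖p.2 - y‖) := by fun_prop
  simpa using this.tendsto (x, y)

variable [NormedSpace ℝ E₂]

/-- The forcing cancels in the difference of the arguments, so only its measurability matters here
and the Lipschitz constant passes to the weighted norm. -/
theorem WeightedBound.nemytskii_sub (hK : 0 ≤ K) {β B σ : ℝ}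
    (hg : ∀ x x' y y', ‖g x y - g x' y'‖ ≤ K * (‖x - x'‖ + ‖y - y'‖))
    {x x' : ℝ → E₁} {y y' z : ℝ → E₂}
    (hx : AEStronglyMeasurable x (volume.restrict (Iic 0)))
    (hy : AEStronglyMeasurable y (volume.restrict (Iic 0)))
    (hx' : AEStronglyMeasurable x' (volume.restrict (Iic 0)))
    (hy' : AEStronglyMeasurable y' (volume.restrict (Iic 0)))
    (hz : AEStronglyMeasurable z (volume.restrict (Iic 0)))
    (hd : ∀ t ≤ 0, ‖x t - x' t‖ + ‖y t - y' t‖ ≤ B * Real.exp (β * t)) :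
    WeightedBound (K * B) β
      (fun s => g (x s) (y s + σ • z s) - g (x' s) (y' s + σ • z s)) := by
  have hc := continuous_of_lipschitz_add hg
  refine ⟨(hc.comp_aestronglyMeasurable (hx.prodMk (hy.add (hz.const_smul σ)))).sub
    (hc.comp_aestronglyMeasurable (hx'.prodMk (hy'.add (hz.const_smul σ)))), fun t ht => ?_⟩
  refine (hg _ _ _ _).trans ?_
  rw [add_sub_add_right_eq_sub, mul_assoc]
  exact mul_le_mul_of_nonneg_left (hd t ht) hK

/-- Comparison with g(0, 0) = 0. Here the size of the forcing enters, which is why it must itself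
lie in the weighted class. -/
theorem WeightedBound.nemytskii (hK : 0 ≤ K) {β Cx Cy Cz σ : ℝ}
    (hg : ∀ x x' y y', ‖g x y - g x' y'‖ ≤ K * (‖x - x'‖ + ‖y - y'‖)) (hg0 : g 0 0 = 0)
    {x : ℝ → E₁} {y z : ℝ → E₂} (hx : WeightedBound Cx β x) (hy : WeightedBound Cy β y)
    (hz : WeightedBound Cz β z) :
    WeightedBound (K * (Cx + (Cy + |σ| * Cz))) β (fun s => g (x s) (y s + σ • z s)) := by
  refine ⟨(continuous_of_lipschitz_add hg).comp_aestronglyMeasurable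
    (hx.meas.prodMk (hy.meas.add (hz.meas.const_smul σ))), fun t ht => ?_⟩
  have h := hg (x t) 0 (y t + σ • z t) 0
  rw [hg0, sub_zero, sub_zero, sub_zero] at h
  refine h.trans ?_
  rw [mul_assoc]
  refine mul_le_mul_of_nonneg_left ?_ hK
  have h1 := norm_add_le (y t) (σ • z t)
  rw [norm_smul, Real.norm_eq_abs] at h1
  have h2 := mul_le_mul_of_nonneg_left (hz.bound t ht) (abs_nonneg σ)
  linarith [hx.bound t ht, hy.bound t ht]

end Nemytskii

namespace System

variable {D : System n₁ n₂} {a b β K γs γf : ℝ} {z : ℝ → Euc n₂}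

/-- The contraction constant of the Lyapunov–Perron operator. -/
def rate (a b β K γs γf : ℝ) : ℝ := a * K / (a * γs - β) + b * K / (β - b * γf)

namespace IsContractive

variable (h : D.IsContractive a b β K γs γf z)
include h

theorem slow_gap : β < a * γs := h.β_neg.trans (mul_pos h.a_pos h.γs_pos)

theorem rate_nonneg : 0 ≤ rate a b β K γs γf := by
  have h1 := sub_pos.2 h.slow_gap
  have h2 := sub_pos.2 h.gap
  have := h.a_pos; have := h.b_pos; have := h.K_nonneg
  unfold rate
  positivity

theorem exists_weighted_g₁ {x : ℝ → Euc n₁} {y : ℝ → Euc n₂}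
    (hx : ∃ C, WeightedBound C β x) (hy : ∃ C, WeightedBound C β y) :
    ∃ C, WeightedBound C β (fun s => D.g₁ (x s) (y s + D.σ • z s)) := by
  obtain ⟨Cx, hx⟩ := hx
  obtain ⟨Cy, hy⟩ := hy
  obtain ⟨Cz, hz⟩ := h.forcing
  exact ⟨_, WeightedBound.nemytskii h.K_nonneg h.lipschitz.g₁_lip h.lipschitz.g₁_zero hx hy hz⟩

theorem exists_weighted_g₂ {x : ℝ → Euc n₁} {y : ℝ → Euc n₂}
    (hx : ∃ C, WeightedBound C β x) (hy : ∃ C, WeightedBound C β y) :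
    ∃ C, WeightedBound C β (fun s => D.g₂ (x s) (y s + D.σ • z s)) := by
  obtain ⟨Cx, hx⟩ := hx
  obtain ⟨Cy, hy⟩ := hy
  obtain ⟨Cz, hz⟩ := h.forcing
  exact ⟨_, WeightedBound.nemytskii h.K_nonneg h.lipschitz.g₂_lip h.lipschitz.g₂_zero hx hy hz⟩

theorem continuousOn_slowMap (x₀ : Euc n₁) {x : ℝ → Euc n₁} {y : ℝ → Euc n₂}
    (hx : ∃ C, WeightedBound C β x) (hy : ∃ C, WeightedBound C β y) :
    ContinuousOn (D.slowMap a z x₀ x y) (Iic 0) := by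
  obtain ⟨C, hC⟩ := h.exists_weighted_g₁ hx hy
  exact continuousOn_duhamel a D.S x₀ fun t ht => hC.intervalIntegrable ht

/-- The integral over (-∞, t] is rewritten as a Duhamel formula started at time 0, whose continuity
is already known. -/
theorem continuousOn_fastMap {x : ℝ → Euc n₁} {y : ℝ → Euc n₂}
    (hx : ∃ C, WeightedBound C β x) (hy : ∃ C, WeightedBound C β y) :
    ContinuousOn (D.fastMap b z x y) (Iic 0) := by
  obtain ⟨C, hC⟩ := h.exists_weighted_g₂ hx hy
  exact (continuousOn_duhamel b D.F _ fun t ht => hC.intervalIntegrable ht).congr fun t ht =>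
    hC.fast_convolution_eq h.linearBounds.fast h.b_pos h.gap ht

theorem exists_weighted_slowMap (x₀ : Euc n₁) {x : ℝ → Euc n₁} {y : ℝ → Euc n₂}
    (hx : ∃ C, WeightedBound C β x) (hy : ∃ C, WeightedBound C β y) :
    ∃ C, WeightedBound C β (D.slowMap a z x₀ x y) := by
  obtain ⟨C, hC⟩ := h.exists_weighted_g₁ hx hy
  refine ⟨‖x₀‖ + a * C / (a * γs - β), (h.continuousOn_slowMap x₀ hx hy).aestronglyMeasurable
    measurableSet_Iic, fun t ht => ?_⟩
  have h1 := h.linearBounds.slow (a * t) (mul_nonpos_of_nonneg_of_nonpos h.a_pos.le ht) x₀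
  have h2 : Real.exp (γs * (a * t)) ≤ Real.exp (β * t) := by
    refine Real.exp_le_exp.2 ?_
    nlinarith [mul_nonneg (sub_nonneg.2 h.slow_gap.le) (neg_nonneg.2 ht)]
  have h3 := hC.norm_slow_convolution_le h.linearBounds.slow h.a_pos h.slow_gap ht
  rw [add_mul]
  refine (norm_add_le _ _).trans (add_le_add (h1.trans ?_) h3)
  rw [mul_comm]
  exact mul_le_mul_of_nonneg_left h2 (norm_nonneg _)

theorem exists_weighted_fastMap {x : ℝ → Euc n₁} {y : ℝ → Euc n₂}
    (hx : ∃ C, WeightedBound C β x) (hy : ∃ C, WeightedBound C β y) :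
    ∃ C, WeightedBound C β (D.fastMap b z x y) := by
  obtain ⟨C, hC⟩ := h.exists_weighted_g₂ hx hy
  exact ⟨_, (h.continuousOn_fastMap hx hy).aestronglyMeasurable measurableSet_Iic,
    fun t ht => hC.norm_fast_convolution_le h.linearBounds.fast h.b_pos h.gap ht⟩

/-- The contraction estimate for the norm sup e^{-βt}(|x| + |y|). The x₀ terms cancel; the slow and
fast convolution bounds contribute the two summands of `rate`. -/
theorem norm_map_sub_le (x₀ : Euc n₁) {x x' : ℝ → Euc n₁} {y y' : ℝ → Euc n₂}
    (hx : ∃ C, WeightedBound C β x) (hy : ∃ C, WeightedBound C β y)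
    (hx' : ∃ C, WeightedBound C β x') (hy' : ∃ C, WeightedBound C β y') {B : ℝ}
    (hd : ∀ t ≤ 0, ‖x t - x' t‖ + ‖y t - y' t‖ ≤ B * Real.exp (β * t)) {t : ℝ} (ht : t ≤ 0) :
    ‖D.slowMap a z x₀ x y t - D.slowMap a z x₀ x' y' t‖ +
      ‖D.fastMap b z x y t - D.fastMap b z x' y' t‖ ≤
        rate a b β K γs γf * B * Real.exp (β * t) := by
  obtain ⟨C₁, h₁⟩ := h.exists_weighted_g₁ hx hy
  obtain ⟨C₂, h₂⟩ := h.exists_weighted_g₂ hx hy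
  obtain ⟨C₁', h₁'⟩ := h.exists_weighted_g₁ hx' hy'
  obtain ⟨C₂', h₂'⟩ := h.exists_weighted_g₂ hx' hy'
  obtain ⟨Cz, hz⟩ := h.forcing
  obtain ⟨_, hx⟩ := hx
  obtain ⟨_, hy⟩ := hy
  obtain ⟨_, hx'⟩ := hx'
  obtain ⟨_, hy'⟩ := hy'
  have d₁ := WeightedBound.nemytskii_sub (σ := D.σ) h.K_nonneg h.lipschitz.g₁_lip hx.meas hy.meas
    hx'.meas hy'.meas hz.meas hd
  have d₂ := WeightedBound.nemytskii_sub (σ := D.σ) h.K_nonneg h.lipschitz.g₂_lip hx.meas hy.meas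
    hx'.meas hy'.meas hz.meas hd
  have e₁ := d₁.norm_slow_convolution_le h.linearBounds.slow h.a_pos h.slow_gap ht
  have e₂ := d₂.norm_fast_convolution_le h.linearBounds.fast h.b_pos h.gap ht
  simp only [map_sub] at e₁ e₂
  rw [intervalIntegral.integral_sub (h₁.intervalIntegrable_convolution ht)
    (h₁'.intervalIntegrable_convolution ht), smul_sub] at e₁
  rw [integral_sub (h₂.integrableOn_fast h.linearBounds.fast h.b_pos h.gap ht)
    (h₂'.integrableOn_fast h.linearBounds.fast h.b_pos h.gap ht), smul_sub] at e₂
  rw [slowMap, slowMap, add_sub_add_left_eq_sub, fastMap, fastMap]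
  refine (add_le_add e₁ e₂).trans (le_of_eq ?_)
  rw [rate]
  ring

theorem exists_weighted_picard (x₀ : Euc n₁) (k : ℕ) :
    (∃ C, WeightedBound C β (D.picard a b z x₀ k).1) ∧
      ∃ C, WeightedBound C β (D.picard a b z x₀ k).2 := by
  induction k with
  | zero => exact ⟨⟨0, aestronglyMeasurable_const, by simp [picard]⟩,
      ⟨0, aestronglyMeasurable_const, by simp [picard]⟩⟩
  | succ k ih => exact ⟨h.exists_weighted_slowMap x₀ ih.1 ih.2, h.exists_weighted_fastMap ih.1 ih.2⟩

/-- The contraction estimate is iterated, starting from the weighted bound of the first iterate,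
since the zeroth is 0. -/
theorem exists_picard_dist_le (x₀ : Euc n₁) : ∃ B, 0 ≤ B ∧ ∀ k : ℕ, ∀ t ≤ 0,
    ‖(D.picard a b z x₀ k).1 t - (D.picard a b z x₀ (k + 1)).1 t‖ +
      ‖(D.picard a b z x₀ k).2 t - (D.picard a b z x₀ (k + 1)).2 t‖ ≤
        rate a b β K γs γf ^ k * B * Real.exp (β * t) := by
  obtain ⟨⟨C, hC⟩, ⟨C', hC'⟩⟩ := h.exists_weighted_picard x₀ 1
  have hB : 0 ≤ C + C' := by
    have h1 := (norm_nonneg _).trans (hC.bound 0 le_rfl)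
    have h2 := (norm_nonneg _).trans (hC'.bound 0 le_rfl)
    simp only [mul_zero, Real.exp_zero, mul_one] at h1 h2
    linarith
  refine ⟨C + C', hB, fun k => ?_⟩
  induction k with
  | zero =>
    intro t ht
    have h1 := hC.bound t ht
    have h2 := hC'.bound t ht
    have h3 : (D.picard a b z x₀ 0).1 t = 0 := rfl
    have h4 : (D.picard a b z x₀ 0).2 t = 0 := rfl
    rw [h3, h4, zero_sub, zero_sub, norm_neg, norm_neg, pow_zero, one_mul, zero_add]
    linarith
  | succ k ih =>
    intro t ht
    have hk := h.exists_weighted_picard x₀ k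
    have hk' := h.exists_weighted_picard x₀ (k + 1)
    have := h.norm_map_sub_le x₀ hk.1 hk.2 hk'.1 hk'.2 ih ht
    rw [← mul_assoc, ← pow_succ'] at this
    exact this

/-- The iterates converge to a fixed point of the Lyapunov–Perron operator. -/
theorem exists_fixedPoint (x₀ : Euc n₁) : ∃ (x : ℝ → Euc n₁) (y : ℝ → Euc n₂),
    (∃ C, WeightedBound C β x) ∧ (∃ C, WeightedBound C β y) ∧
    (∀ t ≤ 0, x t = D.slowMap a z x₀ x y t) ∧ (∀ t ≤ 0, y t = D.fastMap b z x y t) ∧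
    ∀ t ≤ 0, Tendsto (fun k => (D.picard a b z x₀ k).2 t) atTop (𝓝 (y t)) := by
  obtain ⟨B, hB, hd⟩ := h.exists_picard_dist_le x₀
  set κ := rate a b β K γs γf with hκ
  have hκ1 : κ < 1 := h.contraction
  have hκ0 : 0 ≤ κ := h.rate_nonneg
  set X := fun k => (D.picard a b z x₀ k).1 with hX
  set Y := fun k => (D.picard a b z x₀ k).2 with hY
  have hdx : ∀ t ≤ 0, ∀ k, dist (X k t) (X (k + 1) t) ≤ B * Real.exp (β * t) * κ ^ k := by
    intro t ht k
    rw [dist_eq_norm]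
    linarith [hd k t ht, norm_nonneg ((D.picard a b z x₀ k).2 t - (D.picard a b z x₀ (k + 1)).2 t)]
  have hdy : ∀ t ≤ 0, ∀ k, dist (Y k t) (Y (k + 1) t) ≤ B * Real.exp (β * t) * κ ^ k := by
    intro t ht k
    rw [dist_eq_norm]
    linarith [hd k t ht, norm_nonneg ((D.picard a b z x₀ k).1 t - (D.picard a b z x₀ (k + 1)).1 t)]
  -- The limit is pointwise; its values at positive times are arbitrary and never used.
  let x : ℝ → Euc n₁ := fun t => limUnder atTop fun k => X k t
  let y : ℝ → Euc n₂ := fun t => limUnder atTop fun k => Y k t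
  have hx : ∀ t ≤ 0, Tendsto (fun k => X k t) atTop (𝓝 (x t)) := fun t ht =>
    (cauchySeq_of_le_geometric κ _ hκ1 (hdx t ht)).tendsto_limUnder
  have hy : ∀ t ≤ 0, Tendsto (fun k => Y k t) atTop (𝓝 (y t)) := fun t ht =>
    (cauchySeq_of_le_geometric κ _ hκ1 (hdy t ht)).tendsto_limUnder
  have ex : ∀ k, ∀ t ≤ 0, ‖X k t - x t‖ ≤ B / (1 - κ) * κ ^ k * Real.exp (β * t) := by
    intro k t ht
    rw [← dist_eq_norm]
    refine (dist_le_of_le_geometric_of_tendsto κ _ hκ1 (hdx t ht) (hx t ht) k).trans (le_of_eq ?_)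
    ring
  have ey : ∀ k, ∀ t ≤ 0, ‖Y k t - y t‖ ≤ B / (1 - κ) * κ ^ k * Real.exp (β * t) := by
    intro k t ht
    rw [← dist_eq_norm]
    refine (dist_le_of_le_geometric_of_tendsto κ _ hκ1 (hdy t ht) (hy t ht) k).trans (le_of_eq ?_)
    ring
  have wx : WeightedBound (B / (1 - κ)) β x := by
    refine ⟨aestronglyMeasurable_of_tendsto_ae atTop
      (fun k => (h.exists_weighted_picard x₀ k).1.choose_spec.meas)
      ((ae_restrict_mem measurableSet_Iic).mono fun t ht => hx t ht), fun t ht => ?_⟩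
    have := ex 0 t ht
    rwa [show X 0 t = 0 from rfl, zero_sub, norm_neg, pow_zero, mul_one] at this
  have wy : WeightedBound (B / (1 - κ)) β y := by
    refine ⟨aestronglyMeasurable_of_tendsto_ae atTop
      (fun k => (h.exists_weighted_picard x₀ k).2.choose_spec.meas)
      ((ae_restrict_mem measurableSet_Iic).mono fun t ht => hy t ht), fun t ht => ?_⟩
    have := ey 0 t ht
    rwa [show Y 0 t = 0 from rfl, zero_sub, norm_neg, pow_zero, mul_one] at this
  -- The distance of the k-th iterate to the limit is at most B/(1-κ) κ^k in each component, hence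
  -- the factor 2; one application of the operator contributes another κ.
  have est : ∀ t ≤ 0, ∀ k,
      ‖X (k + 1) t - D.slowMap a z x₀ x y t‖ + ‖Y (k + 1) t - D.fastMap b z x y t‖ ≤
        κ * (2 * (B / (1 - κ)) * κ ^ k) * Real.exp (β * t) := by
    intro t ht k
    refine h.norm_map_sub_le x₀ (h.exists_weighted_picard x₀ k).1 (h.exists_weighted_picard x₀ k).2
      ⟨_, wx⟩ ⟨_, wy⟩ (fun s hs => ?_) ht
    linarith [ex k s hs, ey k s hs]
  have lim0 : ∀ t, Tendsto (fun k : ℕ => κ * (2 * (B / (1 - κ)) * κ ^ k) * Real.exp (β * t))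
      atTop (𝓝 0) := by
    intro t
    have := (((tendsto_pow_atTop_nhds_zero_of_lt_one hκ0 hκ1).const_mul
      (2 * (B / (1 - κ)))).const_mul κ).mul_const (Real.exp (β * t))
    simpa using this
  refine ⟨x, y, ⟨_, wx⟩, ⟨_, wy⟩, fun t ht => ?_, fun t ht => ?_, hy⟩
  · refine tendsto_nhds_unique ((hx t ht).comp (tendsto_add_atTop_nat 1)) ?_
    rw [tendsto_iff_norm_sub_tendsto_zero]
    exact squeeze_zero (fun _ => norm_nonneg _)
      (fun k => (le_add_of_nonneg_right (norm_nonneg _)).trans (est t ht k)) (lim0 t)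
  · refine tendsto_nhds_unique ((hy t ht).comp (tendsto_add_atTop_nat 1)) ?_
    rw [tendsto_iff_norm_sub_tendsto_zero]
    exact squeeze_zero (fun _ => norm_nonneg _)
      (fun k => (le_add_of_nonneg_left (norm_nonneg _)).trans (est t ht k)) (lim0 t)

theorem isLyapunovPerron_of_fixedPoint {x₀ : Euc n₁} {x : ℝ → Euc n₁} {y : ℝ → Euc n₂}
    (hx : ∃ C, WeightedBound C β x) (hy : ∃ C, WeightedBound C β y)
    (ex : ∀ t ≤ 0, x t = D.slowMap a z x₀ x y t) (ey : ∀ t ≤ 0, y t = D.fastMap b z x y t) :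
    D.IsLyapunovPerron a b z β x₀ x y := by
  obtain ⟨C₁, h₁⟩ := h.exists_weighted_g₁ hx hy
  obtain ⟨C₂, h₂⟩ := h.exists_weighted_g₂ hx hy
  exact ⟨inWeighted_iff.2 ⟨(h.continuousOn_slowMap x₀ hx hy).congr ex, hx⟩,
    inWeighted_iff.2 ⟨(h.continuousOn_fastMap hx hy).congr ey, hy⟩,
    fun t ht => h₁.intervalIntegrable_convolution ht,
    fun t ht => h₂.integrableOn_fast h.linearBounds.fast h.b_pos h.gap ht, ex, ey⟩

/-- Both pairs are fixed points, so the contraction estimate applies to their difference any number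
of times and forces it to vanish. -/
theorem eqOn_of_isLyapunovPerron {x₀ : Euc n₁} {x x' : ℝ → Euc n₁} {y y' : ℝ → Euc n₂}
    (hφ : D.IsLyapunovPerron a b z β x₀ x y) (hφ' : D.IsLyapunovPerron a b z β x₀ x' y') :
    EqOn x' x (Iic 0) ∧ EqOn y' y (Iic 0) := by
  have wx := (inWeighted_iff.1 hφ.slow_mem).2
  have wy := (inWeighted_iff.1 hφ.fast_mem).2
  have wx' := (inWeighted_iff.1 hφ'.slow_mem).2
  have wy' := (inWeighted_iff.1 hφ'.fast_mem).2
  obtain ⟨Cx, vx⟩ := wx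
  obtain ⟨Cy, vy⟩ := wy
  obtain ⟨Cx', vx'⟩ := wx'
  obtain ⟨Cy', vy'⟩ := wy'
  set B := Cx' + Cx + (Cy' + Cy)
  have key : ∀ k : ℕ, ∀ t ≤ 0, ‖x' t - x t‖ + ‖y' t - y t‖ ≤
      rate a b β K γs γf ^ k * B * Real.exp (β * t) := by
    intro k
    induction k with
    | zero =>
      intro t ht
      rw [pow_zero, one_mul]
      linarith [norm_sub_le (x' t) (x t), norm_sub_le (y' t) (y t), vx.bound t ht,
        vy.bound t ht, vx'.bound t ht, vy'.bound t ht]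
    | succ k ih =>
      intro t ht
      have := h.norm_map_sub_le x₀ ⟨_, vx'⟩ ⟨_, vy'⟩ ⟨_, vx⟩ ⟨_, vy⟩ ih ht
      rw [← mul_assoc, ← pow_succ'] at this
      rw [hφ.slow_eq t ht, hφ.fast_eq t ht, hφ'.slow_eq t ht, hφ'.fast_eq t ht]
      exact this
  have zero : ∀ t ≤ 0, ‖x' t - x t‖ + ‖y' t - y t‖ ≤ 0 := by
    intro t ht
    have lim : Tendsto (fun k : ℕ => rate a b β K γs γf ^ k * B * Real.exp (β * t)) atTop (𝓝 0) := by
      simpa using ((tendsto_pow_atTop_nhds_zero_of_lt_one h.rate_nonneg h.contraction).mul_const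
        B).mul_const (Real.exp (β * t))
    exact ge_of_tendsto' lim fun k => key k t ht
  refine ⟨fun t ht => ?_, fun t ht => ?_⟩
  · exact sub_eq_zero.1 (norm_le_zero_iff.1
      (by linarith [zero t ht, norm_nonneg (x' t - x t), norm_nonneg (y' t - y t)]))
  · exact sub_eq_zero.1 (norm_le_zero_iff.1
      (by linarith [zero t ht, norm_nonneg (x' t - x t), norm_nonneg (y' t - y t)]))

theorem uniquelySolvable (x₀ : Euc n₁) : D.UniquelySolvable a b z β x₀ := by
  obtain ⟨x, y, hx, hy, ex, ey, -⟩ := h.exists_fixedPoint x₀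
  have hφ := h.isLyapunovPerron_of_fixedPoint hx hy ex ey
  exact ⟨x, y, hφ, fun x' y' hφ' => h.eqOn_of_isLyapunovPerron hφ hφ'⟩

/-- The defining integral is the fast equation at t = 0, and uniqueness makes the chosen solution
irrelevant. -/
theorem lyapunovPerronMap_eq {x₀ : Euc n₁} {x : ℝ → Euc n₁} {y : ℝ → Euc n₂}
    (hφ : D.IsLyapunovPerron a b z β x₀ x y) : D.lyapunovPerronMap a b z β x₀ = y 0 := by
  have hex : ∃ φ : (ℝ → Euc n₁) × (ℝ → Euc n₂), D.IsLyapunovPerron a b z β x₀ φ.1 φ.2 :=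
    ⟨(x, y), hφ⟩
  rw [lyapunovPerronMap, dif_pos hex, ← (h.eqOn_of_isLyapunovPerron hφ hex.choose_spec).2
    (mem_Iic.2 le_rfl), hex.choose_spec.fast_eq 0 le_rfl]
  simp

theorem tendsto_picard_lyapunovPerronMap (x₀ : Euc n₁) :
    Tendsto (fun k => (D.picard a b z x₀ k).2 0) atTop (𝓝 (D.lyapunovPerronMap a b z β x₀)) := by
  obtain ⟨x, y, hx, hy, ex, ey, hlim⟩ := h.exists_fixedPoint x₀
  rw [h.lyapunovPerronMap_eq (h.isLyapunovPerron_of_fixedPoint hx hy ex ey)]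
  exact hlim 0 le_rfl

/-! ### The slow manifold is a graph -/

theorem isBackwardSolution {x₀ : Euc n₁} {x : ℝ → Euc n₁} {y : ℝ → Euc n₂}
    (hφ : D.IsLyapunovPerron a b z β x₀ x y) : D.IsBackwardSolution a b z x₀ (y 0) x y := by
  obtain ⟨cx, wx⟩ := inWeighted_iff.1 hφ.slow_mem
  obtain ⟨cy, wy⟩ := inWeighted_iff.1 hφ.fast_mem
  obtain ⟨C₁, h₁⟩ := h.exists_weighted_g₁ wx wy
  obtain ⟨C₂, h₂⟩ := h.exists_weighted_g₂ wx wy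
  have hsub : ∀ t ≤ (0 : ℝ), uIcc 0 t ⊆ Iic 0 := fun t ht => by
    rw [uIcc_of_ge ht]; exact fun s hs => hs.2
  refine ⟨cx, cy, fun t ht => ?_, fun t ht => ?_, ?_, ?_⟩
  · exact (D.S.continuous.comp_continuousOn (cx.mono (hsub t ht))).intervalIntegrable.add
      (h₁.intervalIntegrable ht)
  · exact (D.F.continuous.comp_continuousOn (cy.mono (hsub t ht))).intervalIntegrable.add
      (h₂.intervalIntegrable ht)
  · exact (eq_duhamel_iff a D.S x₀ (fun t ht => h₁.intervalIntegrable ht) cx).2 hφ.slow_eq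
  · refine (eq_duhamel_iff b D.F (y 0) (fun t ht => h₂.intervalIntegrable ht) cy).2 fun t ht => ?_
    have h0 := hφ.fast_eq 0 le_rfl
    simp only [zero_sub, mul_neg] at h0
    rw [h0, hφ.fast_eq t ht]
    exact h₂.fast_convolution_eq h.linearBounds.fast h.b_pos h.gap ht

/-- Variation of constants gives e^{-bFt} y(t) = y₀ - b ∫_t^0 e^{-bFs} g₂ ds. The left side tends to
0 as t → -∞ because y is of order e^{βt} and bγf < β. Thus y₀ is the full integral, and the equation
on (-∞, t] follows. -/
theorem isLyapunovPerron {x₀ : Euc n₁} {y₀ : Euc n₂} {x : ℝ → Euc n₁} {y : ℝ → Euc n₂}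
    (hφ : D.IsBackwardSolution a b z x₀ y₀ x y) (hx : InWeighted β x) (hy : InWeighted β y) :
    D.IsLyapunovPerron a b z β x₀ x y := by
  obtain ⟨cx, wx⟩ := inWeighted_iff.1 hx
  obtain ⟨cy, wy⟩ := inWeighted_iff.1 hy
  obtain ⟨C₁, h₁⟩ := h.exists_weighted_g₁ wx wy
  obtain ⟨C₂, h₂⟩ := h.exists_weighted_g₂ wx wy
  refine h.isLyapunovPerron_of_fixedPoint wx wy
    ((eq_duhamel_iff a D.S x₀ (fun t ht => h₁.intervalIntegrable ht) cx).1 hφ.slow_eq) ?_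
  have hy' := (eq_duhamel_iff b D.F y₀ (fun t ht => h₂.intervalIntegrable ht) cy).1 hφ.fast_eq
  have hI : IntegrableOn (fun s => NormedSpace.exp ((-(b * s)) • D.F)
      (D.g₂ (x s) (y s + D.σ • z s))) (Iic 0) := by
    simpa only [zero_sub, mul_neg] using
      h₂.integrableOn_fast h.linearBounds.fast h.b_pos h.gap (le_refl (0 : ℝ))
  obtain ⟨Cy, vy⟩ := wy
  have hback : ∀ t ≤ 0, NormedSpace.exp ((-(b * t)) • D.F) (y t) =
      y₀ - b • ∫ s in t..0, NormedSpace.exp ((-(b * s)) • D.F) (D.g₂ (x s) (y s + D.σ • z s)) := by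
    intro t ht
    rw [hy' t ht, ← exp_smul_primitive_eq b D.F y₀ (h₂.intervalIntegrable ht)]
    have := exp_smul_neg_apply D.F (-(b * t)) (y₀ + ∫ s in (0 : ℝ)..t,
      b • NormedSpace.exp ((-(b * s)) • D.F) (D.g₂ (x s) (y s + D.σ • z s)))
    rw [neg_neg] at this
    rw [this, intervalIntegral.integral_smul, intervalIntegral.integral_symm t 0, smul_neg,
      sub_eq_add_neg]
  have hlim0 : Tendsto (fun t => NormedSpace.exp ((-(b * t)) • D.F) (y t)) atBot (𝓝 0) := by
    refine squeeze_zero_norm' (a := fun t => Cy * Real.exp ((β - b * γf) * t)) ?_ ?_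
    · filter_upwards [Iic_mem_atBot 0] with t ht
      have ht' : t ≤ 0 := ht
      refine (h.linearBounds.fast _ (by nlinarith [h.b_pos]) _).trans ?_
      refine (mul_le_mul_of_nonneg_left (vy.bound t ht) (Real.exp_pos _).le).trans (le_of_eq ?_)
      rw [show (β - b * γf) * t = γf * -(b * t) + β * t by ring, Real.exp_add]
      ring
    · have : Tendsto (fun t : ℝ => (β - b * γf) * t) atBot atBot :=
        tendsto_id.const_mul_atBot (sub_pos.2 h.gap)
      simpa using (Real.tendsto_exp_atBot.comp this).const_mul Cy
  have hlim1 := ((intervalIntegral_tendsto_integral_Iic 0 hI tendsto_id).const_smul b).const_sub y₀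
  have hy₀ : y₀ = b • ∫ s in Iic (0 : ℝ),
      NormedSpace.exp ((-(b * s)) • D.F) (D.g₂ (x s) (y s + D.σ • z s)) := by
    refine (sub_eq_zero.1 (tendsto_nhds_unique (hlim1.congr' ?_) hlim0))
    filter_upwards [Iic_mem_atBot 0] with t ht
    exact (hback t ht).symm
  intro t ht
  rw [fastMap, h₂.fast_convolution_eq h.linearBounds.fast h.b_pos h.gap ht, ← hy₀]
  exact hy' t ht

theorem slowManifold_eq :
    D.slowManifold a b z β = {p | p.2 = D.lyapunovPerronMap a b z β p.1} := by
  ext ⟨x₀, y₀⟩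
  constructor
  · rintro ⟨x, y, hφ, hx, hy⟩
    have h1 := h.lyapunovPerronMap_eq (h.isLyapunovPerron hφ hx hy)
    have h2 := hφ.fast_eq 0 le_rfl
    rw [intervalIntegral.integral_same, smul_zero, add_zero] at h2
    exact h2.symm.trans h1.symm
  · intro hp
    obtain ⟨x, y, hφ, -⟩ := h.uniquelySolvable x₀
    have h1 := h.isBackwardSolution hφ
    rw [← h.lyapunovPerronMap_eq hφ, ← (hp : y₀ = _)] at h1
    exact ⟨x, y, h1, hφ.slow_mem, hφ.fast_mem⟩

end IsContractive

end System

end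

section

/-! ### Invariances of the law of a stable Lévy process -/

/-- The law of a process with independent increments, started from `0`, is determined by the laws
of its increments. -/
theorem identDistrib_of_hasIndepIncrements {Ω E : Type*} {mΩ : MeasurableSpace Ω}
    [NormedAddCommGroup E] [MeasurableSpace E] [BorelSpace E] [SecondCountableTopology E]
    {P : Measure Ω} [IsProbabilityMeasure P] {X Y : ℝ → Ω → E}
    (mX : ∀ t, Measurable (X t)) (mY : ∀ t, Measurable (Y t))
    (hX : HasIndepIncrements X P) (hY : HasIndepIncrements Y P)
    (hX0 : ∀ ω, X 0 ω = 0) (hY0 : ∀ ω, Y 0 ω = 0)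
    (hXY : ∀ s t, s ≤ t →
      IdentDistrib (fun ω => X t ω - X s ω) (fun ω => Y t ω - Y s ω) P P) :
    IdentDistrib (fun ω t => X t ω) (fun ω t => Y t ω) P P := by
  rw [identDistrib_iff_forall_finset_identDistrib
    (measurable_pi_lambda _ mX).aemeasurable (measurable_pi_lambda _ mY).aemeasurable]
  intro I
  obtain ⟨t, ht, hIt, k₀, hk₀⟩ : ∃ t : ℕ → ℝ, Monotone t ∧ (∀ i ∈ I, ∃ k, t k = i) ∧
      ∃ k, t k = 0 := by
    -- The time 0 is added because both processes vanish there: the value at any other time, of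
    -- either sign, is a difference of two partial sums of increments.
    let J := insert 0 I
    have hJ : J.card = (J.card - 1) + 1 :=
      (Nat.succ_pred_eq_of_pos (Finset.card_pos.2 ⟨0, Finset.mem_insert_self _ _⟩)).symm
    -- The sorted times are prolonged as a constant sequence, so the later increments are zero.
    let t : ℕ → ℝ := fun k => J.orderEmbOfFin hJ ⟨min k (J.card - 1), by omega⟩
    have hmem : ∀ i ∈ J, ∃ k, t k = i := by
      intro i hi
      have : i ∈ Set.range (J.orderEmbOfFin hJ) := by
        rw [Finset.range_orderEmbOfFin]; exact hi
      obtain ⟨k, hk⟩ := this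
      refine ⟨k, hk ▸ congrArg _ (Fin.ext ?_)⟩
      exact min_eq_left (by have := k.2; omega)
    refine ⟨t, fun k l hkl => (J.orderEmbOfFin hJ).monotone ?_,
      fun i hi => hmem i (Finset.mem_insert_of_mem hi), hmem 0 (Finset.mem_insert_self _ _)⟩
    exact Fin.mk_le_mk.2 (min_le_min_right _ hkl)
  choose! κ hκ using hIt
  let f : (ℕ → E) → I → E := fun v i =>
    ∑ j ∈ Finset.range (κ i), v j - ∑ j ∈ Finset.range k₀, v j
  have hf : Measurable f := measurable_pi_lambda _ fun i =>
    (Finset.measurable_sum _ fun j _ => measurable_pi_apply j).sub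
      (Finset.measurable_sum _ fun j _ => measurable_pi_apply j)
  have hrep : ∀ Z : ℝ → Ω → E, (∀ ω, Z 0 ω = 0) →
      (fun ω => I.restrict fun t => Z t ω) =
        f ∘ fun ω k => Z (t (k + 1)) ω - Z (t k) ω := by
    intro Z hZ
    ext ω i
    simp only [f, Function.comp_apply, Finset.restrict_def]
    rw [Finset.sum_range_sub (fun k => Z (t k) ω), Finset.sum_range_sub (fun k => Z (t k) ω),
      hκ i i.2, hk₀, hZ, sub_sub_sub_cancel_right, sub_zero]
  have hlaw : IdentDistrib (fun ω k => X (t (k + 1)) ω - X (t k) ω)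
      (fun ω k => Y (t (k + 1)) ω - Y (t k) ω) P P := by
    have hmX : ∀ k, Measurable fun ω => X (t (k + 1)) ω - X (t k) ω := fun k =>
      (mX _).sub (mX _)
    have hmY : ∀ k, Measurable fun ω => Y (t (k + 1)) ω - Y (t k) ω := fun k =>
      (mY _).sub (mY _)
    refine ⟨(measurable_pi_lambda _ hmX).aemeasurable, (measurable_pi_lambda _ hmY).aemeasurable, ?_⟩
    rw [(hX.nat ht).map_fun_eq_infinitePi_map hmX, (hY.nat ht).map_fun_eq_infinitePi_map hmY]
    congr 1
    ext1 k
    exact (hXY _ _ (ht (Nat.le_succ k))).map_eq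
  rw [hrep X hX0, hrep Y hY0]
  exact hlaw.comp hf

variable {n : ℕ} {α : ℝ} {P : Measure (PathSpace n)}

/-- A map of path space preserves `P` if it preserves the law of the coordinate process. -/
theorem measurePreserving_of_identDistrib {θ : PathSpace n → PathSpace n} (hθ : Measurable θ)
    (h : IdentDistrib (fun (ω : PathSpace n) (t : ℝ) => (θ ω).1 t) (fun ω t => ω.1 t) P P) :
    MeasurePreserving θ P P := by
  refine ⟨hθ, Measure.ext fun A hA => ?_⟩
  obtain ⟨B, hB, rfl⟩ := hA
  rw [Measure.map_apply hθ (measurable_subtype_coe hB)]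
  exact h.measure_mem_eq hB

theorem IsCadlag.rescale {ω : ℝ → Euc n} (h : IsCadlag ω) {c : ℝ} (hc : 0 < c) (r : ℝ) :
    IsCadlag (fun t => r • ω (c * t)) := by
  intro t
  obtain ⟨h₁, l, h₂⟩ := h (c * t)
  have hcont : Tendsto (fun s : ℝ => c * s) (𝓝 t) (𝓝 (c * t)) :=
    (continuous_const.mul continuous_id).tendsto t
  refine ⟨(h₁.comp ?_).const_smul _, r • l, (h₂.comp ?_).const_smul _⟩
  · refine tendsto_nhdsWithin_of_tendsto_nhds_of_eventually_within _
      (hcont.mono_left nhdsWithin_le_nhds) ?_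
    filter_upwards [self_mem_nhdsWithin] with s hs
    exact mul_lt_mul_of_pos_left hs hc
  · refine tendsto_nhdsWithin_of_tendsto_nhds_of_eventually_within _
      (hcont.mono_left nhdsWithin_le_nhds) ?_
    filter_upwards [self_mem_nhdsWithin] with s hs
    exact mul_lt_mul_of_pos_left hs hc

/-- The rescaled path `t ↦ c^{-1/α} ω(c t)`. -/
def rescale (α : ℝ) {c : ℝ} (hc : 0 < c) (ω : PathSpace n) : PathSpace n :=
  ⟨fun t => c ^ (-(1 / α)) • ω.1 (c * t), ω.2.1.rescale hc _, by simp [ω.2.2]⟩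

theorem measurable_rescale (α : ℝ) {c : ℝ} (hc : 0 < c) :
    Measurable (rescale α hc : PathSpace n → PathSpace n) :=
  Measurable.subtype_mk (measurable_pi_lambda _ fun t =>
    (measurable_eval (c * t)).const_smul (c ^ (-(1 / α))))

theorem measurable_shift (t : ℝ) : Measurable (shift t : PathSpace n → PathSpace n) :=
  (measurable_pi_lambda _ fun _ => (measurable_eval _).sub (measurable_eval _)).subtype_mk

namespace IsStableLevy

variable (h : IsStableLevy α P)
include h

theorem identDistrib_sub {s t : ℝ} (hst : s ≤ t) :
    IdentDistrib (fun ω : PathSpace n => ω.1 t - ω.1 s) (fun ω => ω.1 (t - s)) P P := by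
  simpa using h.stationary_increments s (t - s) (sub_nonneg.2 hst)

variable [IsProbabilityMeasure P]

/-- Shifting keeps increments independent, and stationarity keeps their laws; these determine the
law of the process. -/
theorem measurePreserving_shift (r : ℝ) : MeasurePreserving (shift r) P P := by
  refine measurePreserving_of_identDistrib (measurable_shift r) ?_
  refine identDistrib_of_hasIndepIncrements (X := fun t (ω : PathSpace n) => (shift r ω).1 t)
    (Y := fun t (ω : PathSpace n) => ω.1 t)
    (fun t => (measurable_eval t).comp (measurable_shift r)) measurable_eval ?_
    h.indep_increments (fun ω => (shift r ω).2.2) (fun ω => ω.2.2) ?_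
  · intro n t ht
    simpa [shift] using h.indep_increments n (fun i => t i + r) (fun i j hij => by
      simpa using ht hij)
  · intro s t hst
    have := h.identDistrib_sub (add_le_add_left hst r)
    rw [add_sub_add_right_eq_sub] at this
    simpa [shift] using this.trans (h.identDistrib_sub hst).symm

/-- An increment of the rescaled path over length t - s has the law of c^{-1/α} L_{c(t-s)}, and
strict stability turns this into the law of L_{t-s}. This is the only property of the noise behind
the coincidence in law. -/
theorem measurePreserving_rescale {c : ℝ} (hc : 0 < c) :
    MeasurePreserving (rescale α hc) P P := by
  refine measurePreserving_of_identDistrib (measurable_rescale α hc) ?_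
  refine identDistrib_of_hasIndepIncrements (X := fun t (ω : PathSpace n) => (rescale α hc ω).1 t)
    (Y := fun t (ω : PathSpace n) => ω.1 t)
    (fun t => (measurable_eval t).comp (measurable_rescale α hc)) measurable_eval ?_
    h.indep_increments (fun ω => (rescale α hc ω).2.2) (fun ω => ω.2.2) ?_
  · intro n t ht
    have := (h.indep_increments n (fun i => c * t i) (fun i j hij =>
      mul_le_mul_of_nonneg_left (ht hij) hc.le)).comp (fun _ x => c ^ (-(1 / α)) • x)
      (fun _ => measurable_const_smul _)
    simpa [rescale, Function.comp_def, smul_sub] using this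
  · intro s t hst
    refine IdentDistrib.trans ?_ (h.identDistrib_sub hst).symm
    have h1 : IdentDistrib (fun ω : PathSpace n => (rescale α hc ω).1 t - (rescale α hc ω).1 s)
        (fun ω => c ^ (-(1 / α)) • ω.1 (c * (t - s))) P P := by
      have := (h.identDistrib_sub (mul_le_mul_of_nonneg_left hst hc.le)).comp
        (measurable_const_smul (c ^ (-(1 / α))))
      simpa only [rescale, Function.comp_def, ← smul_sub, mul_sub] using this
    refine h1.trans ?_
    -- Increments of zero length are treated apart, since stability is stated for positive times.
    rcases hst.eq_or_lt with rfl | hlt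
    · simp only [sub_self, mul_zero]
      refine IdentDistrib.of_ae_eq ((measurable_eval 0).const_smul (c ^ (-(1 / α)))).aemeasurable ?_
      exact Eventually.of_forall fun ω => by simp [ω.2.2]
    · have hpos := sub_pos.2 hlt
      have h2 := (h.stable (c * (t - s)) (mul_pos hc hpos)).comp (measurable_const_smul (c ^ (-(1 / α))))
      refine h2.trans ?_
      have h3 := (h.stable (t - s) hpos).symm
      convert h3 using 2 with ω
      rw [Function.comp_apply, smul_smul, Real.mul_rpow hc.le hpos.le, ← mul_assoc, ← Real.rpow_add hc]
      simp

end IsStableLevy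

end

section

/-! ### Growth of the paths of a stable Lévy process -/

variable {n : ℕ} {α : ℝ} {P : Measure (PathSpace n)}

/-- The paths that leave the ball of radius `r` during `[0, T]`. -/
def exceed (n : ℕ) (T r : ℝ) : Set (PathSpace n) := {ω | ∃ t ∈ Icc 0 T, r < ‖ω.1 t‖}

/-- By right continuity an excursion before T is seen at a rational time. The endpoint T is listed
separately, as the times to its right lie outside [0, T]. -/
theorem measurableSet_exceed (T r : ℝ) : MeasurableSet (exceed n T r) := by
  have hm : ∀ t : ℝ, MeasurableSet {ω : PathSpace n | r < ‖ω.1 t‖} := fun t =>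
    measurableSet_lt measurable_const (measurable_eval t).norm
  have : exceed n T r = (⋃ q : ℚ, {ω : PathSpace n | (q : ℝ) ∈ Icc 0 T} ∩ {ω | r < ‖ω.1 q‖}) ∪
      ({ω | 0 ≤ T} ∩ {ω | r < ‖ω.1 T‖}) := by
    ext ω
    constructor
    · rintro ⟨t, ht, hr⟩
      rcases ht.2.eq_or_lt with rfl | hlt
      · exact Or.inr ⟨ht.1, hr⟩
      · have h1 : ∀ᶠ s in 𝓝[>] t, r < ‖ω.1 s‖ := (ω.2.1 t).1.norm.eventually_const_lt hr
        obtain ⟨d, hd, hsub⟩ := (mem_nhdsGT_iff_exists_Ioo_subset' hlt).1 h1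
        obtain ⟨q, hq1, hq2⟩ := exists_rat_btwn (lt_min (mem_Ioi.1 hd) hlt)
        refine Or.inl (mem_iUnion.2 ⟨q, ⟨(ht.1.trans hq1.le), (hq2.trans_le (min_le_right _ _)).le⟩, ?_⟩)
        exact hsub ⟨hq1, hq2.trans_le (min_le_left _ _)⟩
    · rintro (h | h)
      · obtain ⟨q, hq, hr⟩ := mem_iUnion.1 h
        exact ⟨q, hq, hr⟩
      · exact ⟨T, ⟨h.1, le_rfl⟩, h.2⟩
  rw [this]
  exact (MeasurableSet.iUnion fun q => (MeasurableSet.const _).inter (hm _)).union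
    ((MeasurableSet.const _).inter (hm _))

theorem exceed_anti (T : ℝ) {r r' : ℝ} (h : r ≤ r') : exceed n T r' ⊆ exceed n T r :=
  fun _ ⟨t, ht, hr⟩ => ⟨t, ht, h.trans_lt hr⟩

/-- A càdlàg path is bounded on [0, 1], so the events decrease to the empty set. No tail estimate
enters. -/
theorem exists_measure_exceed_le [IsProbabilityMeasure P] :
    ∃ r : ℝ, 0 < r ∧ P.real (exceed n 1 r) ≤ 1 / 2 := by
  have hlim : Tendsto (fun k : ℕ => P (exceed n 1 k)) atTop (𝓝 (P (⋂ k : ℕ, exceed n 1 k))) :=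
    tendsto_measure_iInter_atTop (fun k => (measurableSet_exceed _ _).nullMeasurableSet)
      (fun k l hkl => exceed_anti 1 (Nat.cast_le.2 hkl)) ⟨0, measure_ne_top _ _⟩
  have hempty : (⋂ k : ℕ, exceed n 1 (k : ℝ)) = ∅ := by
    refine eq_empty_iff_forall_notMem.2 fun ω hω => ?_
    obtain ⟨C, hC⟩ := ω.2.1.bounded 0 1
    obtain ⟨k, hk⟩ := exists_nat_gt C
    obtain ⟨t, ht, hr⟩ := mem_iInter.1 hω k
    exact absurd (hC t ht) (not_le.2 (hk.trans hr))
  rw [hempty, measure_empty] at hlim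
  have hhalf : (0 : ENNReal) < ENNReal.ofReal (1 / 2) := by simp
  obtain ⟨k, hk, hk1⟩ := ((hlim.eventually_le_const hhalf).and (eventually_ge_atTop 1)).exists
  exact ⟨k, by exact_mod_cast hk1, ENNReal.toReal_le_of_le_ofReal (by norm_num) hk⟩

theorem rescale_preimage_exceed {c : ℝ} (hc : 0 < c) (T r : ℝ) :
    rescale α hc ⁻¹' exceed n T r = exceed n (c * T) (c ^ (1 / α) * r) := by
  have hpos : 0 < c ^ (1 / α) := Real.rpow_pos_of_pos hc _
  have key : ∀ (ω : PathSpace n) (t : ℝ),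
      r < ‖c ^ (-(1 / α)) • ω.1 t‖ ↔ c ^ (1 / α) * r < ‖ω.1 t‖ := by
    intro ω t
    rw [norm_smul, Real.rpow_neg hc.le, norm_inv, Real.norm_of_nonneg hpos.le, inv_mul_eq_div,
      lt_div_iff₀' hpos]
  ext ω
  constructor
  · rintro ⟨t, ht, hr⟩
    exact ⟨c * t, ⟨mul_nonneg hc.le ht.1, mul_le_mul_of_nonneg_left ht.2 hc.le⟩, (key ω _).1 hr⟩
  · rintro ⟨t, ht, hr⟩
    refine ⟨t / c, ⟨div_nonneg ht.1 hc.le, (div_le_iff₀' hc).2 ht.2⟩, (key ω _).2 ?_⟩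
    rwa [mul_div_cancel₀ _ hc.ne']

/-! ### From excursions on [0, N] to excursions on [0, 1] by independence -/

/-- The paths that stay within distance `r` of `ω(k)` at the times `k + i / M`, `i ≤ M`. -/
def staysNear (n M : ℕ) (r : ℝ) (k : ℕ) : Set (PathSpace n) :=
  {ω | ∀ i ≤ M, ‖ω.1 (((k * M + i : ℕ) : ℝ) / M) - ω.1 (((k * M : ℕ) : ℝ) / M)‖ ≤ r}

/-- The increment over the `j`-th interval of the grid of mesh `1 / M`. -/
def gridIncrement (M : ℕ) (j : ℕ) (ω : PathSpace n) : Euc n :=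
  ω.1 (((j + 1 : ℕ) : ℝ) / M) - ω.1 ((j : ℝ) / M)

theorem measurable_gridIncrement (M j : ℕ) :
    Measurable (gridIncrement M j : PathSpace n → Euc n) :=
  (measurable_eval _).sub (measurable_eval _)

/-- The event `staysNear` in terms of a sequence of increments. -/
def staysNearSeq (E : Type*) [NormedAddCommGroup E] (M : ℕ) (r : ℝ) (k : ℕ) : Set (ℕ → E) :=
  {v | ∀ i ≤ M, ‖∑ j ∈ Finset.Ico (k * M) (k * M + i), v j‖ ≤ r}

theorem measurableSet_staysNearSeq (M : ℕ) (r : ℝ) (k : ℕ) :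
    MeasurableSet (staysNearSeq (Euc n) M r k) := by
  have : staysNearSeq (Euc n) M r k =
      ⋂ i : ℕ, ⋂ _ : i ≤ M, {v | ‖∑ j ∈ Finset.Ico (k * M) (k * M + i), v j‖ ≤ r} := by
    ext v; simp [staysNearSeq]
  rw [this]
  exact MeasurableSet.iInter fun i => MeasurableSet.iInter fun _ =>
    measurableSet_le (Finset.measurable_sum _ fun j _ => measurable_pi_apply j).norm
      measurable_const

theorem mem_staysNear_iff {M k : ℕ} {r : ℝ} {ω : PathSpace n} {v : ℕ → Euc n}
    (hv : ∀ j ∈ Finset.Ico (k * M) (k * M + M), v j = gridIncrement M j ω) :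
    ω ∈ staysNear n M r k ↔ v ∈ staysNearSeq (Euc n) M r k := by
  refine forall₂_congr fun i hi => ?_
  rw [Finset.sum_congr rfl fun j hj => hv j (Finset.Ico_subset_Ico_right (by omega) hj)]
  simp only [gridIncrement]
  rw [Finset.sum_Ico_sub (fun j : ℕ => ω.1 ((j : ℝ) / M)) (by omega)]

theorem measurableSet_staysNear (M : ℕ) (r : ℝ) (k : ℕ) : MeasurableSet (staysNear n M r k) := by
  have : staysNear n M r k =
      (fun ω j => gridIncrement M j ω) ⁻¹' staysNearSeq (Euc n) M r k := by
    ext ω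
    exact mem_staysNear_iff fun _ _ => rfl
  rw [this]
  exact measurable_pi_lambda _ (measurable_gridIncrement M) (measurableSet_staysNearSeq M r k)

theorem shift_preimage_staysNear {M : ℕ} (hM : 0 < M) (r : ℝ) (k : ℕ) :
    shift (k : ℝ) ⁻¹' staysNear n M r 0 = staysNear n M r k := by
  have hM' : (M : ℝ) ≠ 0 := by positivity
  ext ω
  refine forall₂_congr fun i _ => ?_
  simp only [shift, zero_mul, zero_add, Nat.cast_zero, zero_div, sub_self, sub_zero]
  push_cast
  rw [add_div, mul_div_cancel_right₀ _ hM', add_comm]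

namespace IsStableLevy

variable [IsProbabilityMeasure P] (h : IsStableLevy α P)
include h

theorem measure_exceed_mul {c : ℝ} (hc : 0 < c) (T r : ℝ) :
    P.real (exceed n (c * T) (c ^ (1 / α) * r)) = P.real (exceed n T r) := by
  rw [← rescale_preimage_exceed hc, measureReal_def, measureReal_def,
    (h.measurePreserving_rescale hc).measure_preimage (measurableSet_exceed _ _).nullMeasurableSet]

/-- The events for different k depend on disjoint blocks of grid increments, hence are independent,
and the shift by k gives them equal probability. -/
theorem measure_iInter_staysNear {M : ℕ} (hM : 0 < M) (r : ℝ) (N : ℕ) :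
    P (⋂ k ∈ Finset.range N, staysNear n M r k) = P (staysNear n M r 0) ^ N := by
  have hind : iIndepFun (fun j => (gridIncrement M j : PathSpace n → Euc n)) P := by
    refine h.indep_increments.nat (t := fun j : ℕ => (j : ℝ) / M) fun i j hij => ?_
    exact div_le_div_of_nonneg_right (Nat.cast_le.2 hij) (by positivity)
  induction N with
  | zero => simp
  | succ N ih =>
    rw [Finset.range_add_one, Finset.set_biInter_insert, inter_comm, pow_succ, ← ih]
    have hshift : P (staysNear n M r N) = P (staysNear n M r 0) := by
      rw [← shift_preimage_staysNear hM]
      exact (h.measurePreserving_shift _).measure_preimage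
        (measurableSet_staysNear M r 0).nullMeasurableSet
    rw [← hshift]
    let S := Finset.range (N * M)
    let T := Finset.Ico (N * M) (N * M + M)
    have hST : Disjoint S T := by
      rw [Finset.disjoint_left]
      intro j hj hj'
      have := Finset.mem_range.1 hj
      have := (Finset.mem_Ico.1 hj').1
      omega
    -- Increments indexed by a block are extended by 0 to a sequence; the events concerned read only
    -- indices inside the block.
    let ext : ∀ U : Finset ℕ, (U → Euc n) → ℕ → Euc n := fun U v j =>
      if hj : j ∈ U then v ⟨j, hj⟩ else 0
    have hext : ∀ U, Measurable (ext U) := by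
      intro U
      refine measurable_pi_lambda _ fun j => ?_
      by_cases hj : j ∈ U
      · simpa [ext, hj] using measurable_pi_apply _
      · simp [ext, hj]
    have hextv : ∀ (U : Finset ℕ) (ω : PathSpace n), ∀ j ∈ U,
        ext U (fun i : U => gridIncrement M i ω) j = gridIncrement M j ω := fun U ω j hj => by
      simp [ext, hj]
    have hI := (hind.indepFun_finset S T hST (measurable_gridIncrement M)).measure_inter_preimage_eq_mul
      _ _ (hext S (MeasurableSet.biInter (Finset.range N).countable_toSet
        fun k _ => measurableSet_staysNearSeq (n := n) M r k))
      (hext T (measurableSet_staysNearSeq M r N))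
    have e1 : (⋂ k ∈ Finset.range N, staysNear n M r k) =
        (fun ω (i : S) => gridIncrement M i ω) ⁻¹' (ext S ⁻¹'
          (⋂ k ∈ (Finset.range N : Set ℕ), staysNearSeq (Euc n) M r k)) := by
      ext ω
      simp only [mem_iInter, mem_preimage, SetLike.mem_coe]
      refine forall₂_congr fun k hk => mem_staysNear_iff fun j hj => hextv S ω j ?_
      have h1 := Finset.mem_range.1 hk
      have h2 := (Finset.mem_Ico.1 hj).2
      exact Finset.mem_range.2 (h2.trans_le (by nlinarith))
    have e2 : staysNear n M r N = (fun ω (i : T) => gridIncrement M i ω) ⁻¹' (ext T ⁻¹'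
          staysNearSeq (Euc n) M r N) := by
      ext ω
      exact mem_staysNear_iff fun j hj => hextv T ω j hj
    rw [e1, e2]
    exact hI

/-- Two grid values in the ball of radius r are at distance at most 2r, so p^N ≥ 1/2 for the
probability p of staying near on one block. Bernoulli's inequality then bounds N(1 - p) by 1. -/
theorem mul_measure_compl_staysNear_le {M N : ℕ} (hM : 0 < M) {r : ℝ}
    (hr : P.real (exceed n N r) ≤ 1 / 2) :
    N * P.real (staysNear n M (2 * r) 0)ᶜ ≤ 1 := by
  have hM' : (0 : ℝ) < M := by positivity
  set p := P.real (staysNear n M (2 * r) 0)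
  have hp0 : 0 ≤ p := measureReal_nonneg
  have hp1 : p ≤ 1 := measureReal_le_one
  have hsub : (⋂ k ∈ Finset.range N, staysNear n M (2 * r) k)ᶜ ⊆ exceed n N r := by
    intro ω hω
    by_contra hne
    refine hω (mem_iInter₂.2 fun k hk i hi => ?_)
    have hb : ∀ j : ℕ, j ≤ N * M → ‖ω.1 ((j : ℝ) / M)‖ ≤ r := by
      intro j hj
      by_contra hlt
      refine hne ⟨_, ⟨by positivity, ?_⟩, not_le.1 hlt⟩
      rw [div_le_iff₀ hM']
      exact_mod_cast hj
    have hk' := Finset.mem_range.1 hk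
    have h1 := hb (k * M + i) (by nlinarith)
    have h2 := hb (k * M) (by nlinarith)
    linarith [norm_sub_le (ω.1 (((k * M + i : ℕ) : ℝ) / M)) (ω.1 (((k * M : ℕ) : ℝ) / M))]
  have hmeas : MeasurableSet (⋂ k ∈ Finset.range N, staysNear n M (2 * r) k) :=
    Finset.measurableSet_biInter _ fun k _ => measurableSet_staysNear M _ k
  have hpow : P.real (⋂ k ∈ Finset.range N, staysNear n M (2 * r) k) = p ^ N := by
    rw [measureReal_def, h.measure_iInter_staysNear hM, ENNReal.toReal_pow]
    rfl
  have h1 : 1 - p ^ N ≤ 1 / 2 := by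
    rw [← hpow, ← probReal_compl_eq_one_sub hmeas]
    exact (measureReal_mono hsub).trans hr
  rw [probReal_compl_eq_one_sub (measurableSet_staysNear M _ 0)]
  change N * (1 - p) ≤ 1
  have h2 : 1 + N * (1 - p) ≤ (1 + (1 - p)) ^ N :=
    one_add_mul_le_pow (by linarith) N
  -- The base of the product is (2 - p)p = 1 - (1 - p)², which is at most 1.
  have h3 : (1 + (1 - p)) ^ N * p ^ N ≤ 1 := by
    rw [← mul_pow]
    exact pow_le_one₀ (by nlinarith) (by nlinarith)
  have h4 : 0 ≤ N * (1 - p) := mul_nonneg (by positivity) (by linarith)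
  nlinarith

/-- The grid bound does not depend on the mesh. Dyadic grids are nested, and by right continuity
their events exhaust the excursion event. -/
theorem mul_measure_exceed_le {N : ℕ} {r : ℝ}
    (hr : P.real (exceed n N r) ≤ 1 / 2) : N * P.real (exceed n 1 (2 * r)) ≤ 1 := by
  let B : ℕ → Set (PathSpace n) := fun m => (staysNear n (2 ^ m) (2 * r) 0)ᶜ
  have hmono : Monotone B := by
    refine monotone_nat_of_le_succ fun m => compl_subset_compl.2 fun ω hω i hi => ?_
    have := hω (2 * i) (by rw [pow_succ]; omega)
    have e : ∀ i : ℕ, ((2 * i : ℕ) : ℝ) / ((2 ^ (m + 1) : ℕ) : ℝ) = (i : ℝ) / ((2 ^ m : ℕ) : ℝ) := by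
      intro i
      push_cast
      rw [pow_succ, mul_comm (2 ^ m : ℝ) 2, mul_div_mul_left _ _ two_ne_zero]
    simpa only [zero_mul, zero_add, e, Nat.cast_zero, zero_div] using this
  have hsub : exceed n 1 (2 * r) ⊆ ⋃ m, B m := by
    rintro ω ⟨t, ht, hlt⟩
    rw [mem_iUnion]
    rcases ht.2.eq_or_lt with rfl | ht1
    · refine ⟨0, fun hω => ?_⟩
      have := hω 1 (by simp)
      simp [ω.2.2] at this
      linarith
    -- The index 2^m - 1 gives `gridAbove` the mesh 2^{-m}. As t < 1, the grid point above t
    -- eventually lies in [0, 1].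
    · have hsub : Tendsto (fun m : ℕ => 2 ^ m - 1) atTop atTop :=
        (tendsto_sub_atTop_nat 1).comp (tendsto_pow_atTop_atTop_of_one_lt one_lt_two)
      have hg := (tendsto_gridAbove t).comp hsub
      have hlim := ((ω.2.1 t).1.norm.comp hg).eventually_const_lt hlt
      have hle := (tendsto_nhds_of_tendsto_nhdsWithin hg).eventually_le_const ht1
      obtain ⟨m, hm, hm1⟩ := (hlim.and hle).exists
      refine ⟨m, fun hω => ?_⟩
      have hcast : ((2 ^ m - 1 : ℕ) : ℝ) + 1 = 2 ^ m := by
        rw [Nat.cast_sub Nat.one_le_two_pow]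
        push_cast
        ring
      simp only [Function.comp_apply, gridAbove, hcast] at hm hm1
      have hfl : 0 ≤ ⌊t * 2 ^ m⌋ := Int.floor_nonneg.2 (mul_nonneg ht.1 (by positivity))
      obtain ⟨j, hj⟩ := Int.eq_ofNat_of_zero_le hfl
      rw [hj] at hm hm1
      have hpos : (0 : ℝ) < 2 ^ m := by positivity
      rw [div_le_one hpos] at hm1
      have := hω (j + 1) (by exact_mod_cast hm1)
      simp [ω.2.2] at this hm
      linarith
  have hlim := tendsto_measure_iUnion_atTop (μ := P) hmono
  have hlim' : Tendsto (fun m => N * P.real (B m)) atTop (𝓝 (N * P.real (⋃ m, B m))) :=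
    (((ENNReal.tendsto_toReal (measure_ne_top _ _)).comp hlim)).const_mul _
  have := le_of_tendsto' hlim' fun m => h.mul_measure_compl_staysNear_le (by positivity) hr
  exact (mul_le_mul_of_nonneg_left (measureReal_mono hsub) (by positivity)).trans this

/-- Almost every path grows at most polynomially at `-∞`. -/
theorem ae_growth (hα : 1 < α) :
    ∀ᵐ ω ∂P, ∃ C : ℝ, ∀ t ≤ 0, ‖ω.1 t‖ ≤ C * (1 - t) ^ 3 := by
  obtain ⟨r, hr, hr2⟩ := exists_measure_exceed_le (P := P)
  have hα1 : 1 / α ≤ 1 := by rw [div_le_one (by linarith)]; exact hα.le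
  have tail : ∀ N : ℕ, 0 < N → P.real (exceed n N (2 * r * N ^ 3)) ≤ 1 / (N : ℝ) ^ 2 := by
    intro N hN
    have hN' : (0 : ℝ) < N := by positivity
    have hN1 : (1 : ℝ) ≤ N := by exact_mod_cast hN
    have hN2 : (0 : ℝ) < ((N ^ 2 : ℕ) : ℝ) := by positivity
    -- The median-type bound on [0, 1] is scaled to [0, N²]. Splitting into N² unit blocks yields
    -- the summable probability N^{-2}, and scaling once more reaches [0, N].
    have h1 : P.real (exceed n ((N ^ 2 : ℕ) : ℝ) (((N ^ 2 : ℕ) : ℝ) ^ (1 / α) * r)) ≤ 1 / 2 := by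
      have := h.measure_exceed_mul hN2 1 r
      rw [mul_one] at this
      rwa [this]
    have h2 := h.mul_measure_exceed_le h1
    rw [← h.measure_exceed_mul hN', mul_one] at h2
    have h3 : (N : ℝ) ^ (1 / α) * (2 * (((N ^ 2 : ℕ) : ℝ) ^ (1 / α) * r)) ≤ 2 * r * N ^ 3 := by
      have e1 : (N : ℝ) ^ (1 / α) ≤ N := by
        simpa using Real.rpow_le_rpow_of_exponent_le hN1 hα1
      have e2 : ((N ^ 2 : ℕ) : ℝ) ^ (1 / α) ≤ (N : ℝ) ^ 2 := by
        have : (1 : ℝ) ≤ ((N ^ 2 : ℕ) : ℝ) := by exact_mod_cast Nat.one_le_pow _ _ hN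
        simpa using Real.rpow_le_rpow_of_exponent_le this hα1
      calc _ ≤ (N : ℝ) * (2 * ((N : ℝ) ^ 2 * r)) := by gcongr
        _ = _ := by ring
    have h4 := measureReal_mono (μ := P) (exceed_anti (n := n) N h3)
    rw [le_div_iff₀ (by positivity)]
    push_cast at h2
    have h5 : (0 : ℝ) ≤ (N : ℝ) ^ 2 := by positivity
    calc _ = (N : ℝ) ^ 2 * P.real (exceed n N (2 * r * N ^ 3)) := mul_comm _ _
      _ ≤ _ := mul_le_mul_of_nonneg_left h4 h5
      _ ≤ 1 := by simpa using h2
  -- The shift moves the window [0, N] to [-N, 0], where the control is needed.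
  let G : ℕ → Set (PathSpace n) := fun N => shift (-(N : ℝ)) ⁻¹' exceed n N (2 * r * N ^ 3)
  have hG : ∑' N, P (G N) ≠ ⊤ := by
    have hs : Summable fun N : ℕ => P.real (G N) := by
      refine Summable.of_norm_bounded_eventually_nat (g := fun N : ℕ => 1 / (N : ℝ) ^ 2)
        (Real.summable_one_div_nat_pow.2 one_lt_two) ?_
      filter_upwards [eventually_gt_atTop 0] with N hN
      rw [Real.norm_of_nonneg measureReal_nonneg, measureReal_def,
        (h.measurePreserving_shift _).measure_preimage
          (measurableSet_exceed _ _).nullMeasurableSet]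
      exact tail N hN
    have : ∀ N, P (G N) = ENNReal.ofReal (P.real (G N)) := fun N =>
      (ofReal_measureReal (measure_ne_top _ _)).symm
    simp_rw [this]
    rw [← ENNReal.ofReal_tsum_of_nonneg (fun _ => measureReal_nonneg) hs]
    exact ENNReal.ofReal_ne_top
  filter_upwards [ae_eventually_notMem hG] with ω hω
  obtain ⟨N₀, hN₀⟩ := eventually_atTop.1 hω
  refine ⟨4 * r * (N₀ + 1) ^ 3, fun t ht => ?_⟩
  -- This N reaches back to t and is beyond the Borel–Cantelli threshold. Both ω(t) and ω(0) = 0 are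
  -- then compared with ω(-N), which yields 4rN³.
  set N := max N₀ ⌈-t⌉₊ with hNdef
  have hNt : -t ≤ N := (Nat.le_ceil _).trans (Nat.cast_le.2 (le_max_right _ _))
  have hNle : (N : ℝ) ≤ (N₀ + 1) * (1 - t) := by
    have h1 : (N : ℝ) ≤ N₀ + ⌈-t⌉₊ := by
      exact_mod_cast max_le (Nat.le_add_right _ _) (Nat.le_add_left _ _)
    have h2 := (Nat.ceil_lt_add_one (neg_nonneg.2 ht)).le
    have h3 : (0 : ℝ) ≤ N₀ := by positivity
    nlinarith
  have hb : ∀ s ∈ Icc (0 : ℝ) N, ‖ω.1 (s + -N) - ω.1 (-N)‖ ≤ 2 * r * N ^ 3 := by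
    intro s hs
    by_contra hlt
    exact hN₀ N (le_max_left _ _) ⟨s, hs, not_le.1 hlt⟩
  have h1 := hb (t + N) ⟨by linarith, by linarith⟩
  have h2 := hb N ⟨by positivity, le_rfl⟩
  rw [add_neg_cancel, ω.2.2] at h2
  rw [add_neg_cancel_right] at h1
  have h3 : ω.1 t = (ω.1 t - ω.1 (-N)) - (0 - ω.1 (-N)) := by abel
  calc ‖ω.1 t‖ ≤ ‖ω.1 t - ω.1 (-N)‖ + ‖0 - ω.1 (-N)‖ := by
        conv_lhs => rw [h3]
        exact norm_sub_le _ _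
    _ ≤ 4 * r * N ^ 3 := by linarith
    _ ≤ 4 * r * ((N₀ + 1) * (1 - t)) ^ 3 := by gcongr
    _ = _ := by ring

end IsStableLevy

/-- It is the cube of 1 - t ≤ (1 + 3/c) e^{-ct/3}, which follows from x + 1 ≤ e^x. -/
theorem exists_growthBound {ω : ℝ → Euc n} {C c : ℝ} (hc : 0 < c)
    (h : ∀ t ≤ 0, ‖ω t‖ ≤ C * (1 - t) ^ 3) : ∃ C', GrowthBound C' c ω := by
  have hC : 0 ≤ C := by simpa using (norm_nonneg _).trans (h 0 le_rfl)
  refine ⟨C * (1 + 3 / c) ^ 3, fun t ht => (h t ht).trans ?_⟩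
  rw [mul_assoc]
  refine mul_le_mul_of_nonneg_left ?_ hC
  have h1 : 1 - t ≤ (1 + 3 / c) * Real.exp (-(c * t) / 3) := by
    have h2 := Real.add_one_le_exp (-(c * t) / 3)
    have h3 : 1 - t ≤ (1 + 3 / c) * (-(c * t) / 3 + 1) := by
      have : (1 + 3 / c) * (-(c * t) / 3 + 1) = 1 - t + (-(c * t) / 3 + 3 / c) := by
        field_simp
        ring
      rw [this]
      have : 0 ≤ -(c * t) / 3 + 3 / c := by
        have : 0 ≤ -(c * t) := by nlinarith
        positivity
      linarith
    exact h3.trans (mul_le_mul_of_nonneg_left h2 (by positivity))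
  calc (1 - t) ^ 3 ≤ ((1 + 3 / c) * Real.exp (-(c * t) / 3)) ^ 3 :=
        pow_le_pow_left₀ (by linarith) h1 3
    _ = (1 + 3 / c) ^ 3 * Real.exp (-(c * t)) := by
        rw [mul_pow, ← Real.exp_nat_mul]
        congr 2
        push_cast
        ring

end

section

/-! ### The stationary processes along paths of polynomial growth -/

variable {n₁ n₂ : ℕ}

/-- The path grows at most polynomially at `-∞`. -/
def Tempered {n : ℕ} (ω : PathSpace n) : Prop := ∃ C : ℝ, ∀ t ≤ 0, ‖ω.1 t‖ ≤ C * (1 - t) ^ 3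

theorem Tempered.rescale {n : ℕ} {ω : PathSpace n} (h : Tempered ω) (α : ℝ) {c : ℝ} (hc : 0 < c) :
    Tempered (rescale α hc ω) := by
  obtain ⟨C, hC⟩ := h
  have hC0 : 0 ≤ C := by simpa using (norm_nonneg _).trans (hC 0 le_rfl)
  refine ⟨‖c ^ (-(1 / α))‖ * (C * (1 + c) ^ 3), fun t ht => ?_⟩
  have h1 := hC (c * t) (mul_nonpos_of_nonneg_of_nonpos hc.le ht)
  change ‖c ^ (-(1 / α)) • ω.1 (c * t)‖ ≤ _
  rw [norm_smul, mul_assoc]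
  refine mul_le_mul_of_nonneg_left (h1.trans ?_) (norm_nonneg _)
  rw [mul_assoc, ← mul_pow]
  refine mul_le_mul_of_nonneg_left (pow_le_pow_left₀ ?_ ?_ 3) hC0
  · nlinarith
  · nlinarith

/-! ### Change of variables and measurability of integrals with moving endpoints -/

theorem integral_Iic_comp_mul_left {E : Type*} [NormedAddCommGroup E] [NormedSpace ℝ E]
    (f : ℝ → E) (b : ℝ) {c : ℝ} (hc : 0 < c) :
    ∫ s in Iic (c * b), f s = c • ∫ s in Iic b, f (c * s) := by
  have h := Measure.integral_comp_mul_left (indicator (Iic (c * b)) f) c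
  rw [integral_indicator measurableSet_Iic, abs_of_pos (inv_pos.2 hc)] at h
  have h2 : (fun s => indicator (Iic (c * b)) f (c * s)) =
      indicator (Iic b) (fun s => f (c * s)) := by
    ext s
    simp only [indicator_apply, mem_Iic, mul_le_mul_iff_right₀ hc]
  rw [h2, integral_indicator measurableSet_Iic] at h
  rw [h, smul_smul, mul_inv_cancel₀ hc.ne', one_smul]

theorem measurable_intervalIntegral_zero {Ω E : Type*} [MeasurableSpace Ω]
    [NormedAddCommGroup E] [NormedSpace ℝ E] [MeasurableSpace E] [BorelSpace E]
    [SecondCountableTopology E] {f : (Ω × ℝ) × ℝ → E} (hf : Measurable f) :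
    Measurable fun p : Ω × ℝ => ∫ s in (0 : ℝ)..p.2, f (p, s) := by
  have h1 : MeasurableSet {q : (Ω × ℝ) × ℝ | q.2 ∈ Ioc 0 q.1.2} :=
    (measurableSet_lt measurable_const measurable_snd).inter
      (measurableSet_le measurable_snd measurable_fst.snd)
  have h2 : MeasurableSet {q : (Ω × ℝ) × ℝ | q.2 ∈ Ioc q.1.2 0} :=
    (measurableSet_lt measurable_fst.snd measurable_snd).inter
      (measurableSet_le measurable_snd measurable_const)
  have m1 := ((hf.indicator h1).stronglyMeasurable.integral_prod_right' (ν := volume)).measurable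
  have m2 := ((hf.indicator h2).stronglyMeasurable.integral_prod_right' (ν := volume)).measurable
  convert m1.sub m2 using 1
  ext1 p
  rw [intervalIntegral, ← integral_indicator measurableSet_Ioc,
    ← integral_indicator measurableSet_Ioc]
  rfl

theorem measurable_integral_Iic {Ω E : Type*} [MeasurableSpace Ω]
    [NormedAddCommGroup E] [NormedSpace ℝ E] [MeasurableSpace E] [BorelSpace E]
    [SecondCountableTopology E] {f : (Ω × ℝ) × ℝ → E} (hf : Measurable f) :
    Measurable fun p : Ω × ℝ => ∫ s in Iic p.2, f (p, s) := by
  have h1 : MeasurableSet {q : (Ω × ℝ) × ℝ | q.2 ∈ Iic q.1.2} :=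
    measurableSet_le measurable_snd measurable_fst.snd
  have m1 := ((hf.indicator h1).stronglyMeasurable.integral_prod_right' (ν := volume)).measurable
  convert m1 using 1
  ext1 p
  rw [← integral_indicator measurableSet_Iic]
  rfl

namespace System

variable {D : System n₁ n₂} {γ γs γf K ε α : ℝ}

theorem LinearBounds.exp_smul_inv_le (h : D.LinearBounds γs γf) (hε : 0 < ε) (t : ℝ) (ht : 0 ≤ t)
    (y : Euc n₂) :
    ‖NormedSpace.exp (t • (ε⁻¹ • D.F)) y‖ ≤ Real.exp (-(-γf / ε * t)) * ‖y‖ := by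
  rw [smul_smul]
  refine (h.fast _ (mul_nonneg ht (inv_pos.2 hε).le) y).trans (le_of_eq ?_)
  congr 2
  ring

theorem kernel_eq (D : System n₁ n₂) (ε : ℝ) :
    D.kernel ε = fun s => NormedSpace.exp ((-s) • (ε⁻¹ • D.F)) := by
  ext1 s
  rw [kernel, smul_smul, div_eq_mul_inv]

section Convergence

variable {ω : PathSpace n₂} (h : D.LinearBounds γs γf) (hγ : 0 < γ) (hγf : γ < -γf) (hε : 0 < ε)
  (hω : Tempered ω)
include h hγ hγf hε hω

/-- Polynomial growth lies below every exponential. The rate γ/ε is chosen since it is smaller than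
the decay rate -γf/ε and equals minus the weight exponent of the first system. -/
theorem hasStieltjesIntegralIic_kernel (t : ℝ) :
    HasStieltjesIntegralIic (D.kernel ε) (shift t ω).1
      (ouIntegral (ε⁻¹ • D.F) (shift t ω).1) := by
  obtain ⟨C, hC⟩ := hω
  obtain ⟨C', hC'⟩ := exists_growthBound (div_pos hγ hε) hC
  obtain ⟨C'', hC''⟩ := hC'.exists_shift (div_pos hγ hε) t
  rw [kernel_eq]
  exact hasStieltjesIntegralIic_exp (h.exp_smul_inv_le hε) (div_lt_div_of_pos_right hγf hε) hC''

/-- The growth constant of the shifted path is 2C' e^{-γt/ε}, and the integral is linear in it. -/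
theorem exists_weightedBound_ouIntegral :
    ∃ C, WeightedBound C (-γ / ε) fun t => ouIntegral (ε⁻¹ • D.F) (shift t ω).1 := by
  obtain ⟨C, hC⟩ := hω
  obtain ⟨C', hC'⟩ := exists_growthBound (div_pos hγ hε) hC
  refine ⟨‖ε⁻¹ • D.F‖ * (2 * C') / (-γf / ε - γ / ε),
    ((measurable_ouIntegral_shift (ε⁻¹ • D.F)).comp
      measurable_prodMk_left).aestronglyMeasurable, fun t ht => ?_⟩
  refine (norm_ouIntegral_le (h.exp_smul_inv_le hε) (div_lt_div_of_pos_right hγf hε)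
    (hC'.shift_of_nonpos (div_pos hγ hε) ht)).trans (le_of_eq ?_)
  rw [show -(γ / ε * t) = -γ / ε * t by ring]
  ring

theorem etaPath_eq :
    D.etaPath α ε ω = fun t => ε ^ (-(1 / α)) • ouIntegral (ε⁻¹ • D.F) (shift t ω).1 := by
  ext1 t
  rw [etaPath, eta, (hasStieltjesIntegralIic_kernel h hγ hγf hε hω t).stieltjesIntegralIic_eq]

theorem exists_weightedBound_etaPath : ∃ C, WeightedBound C (-γ / ε) (D.etaPath α ε ω) := by
  obtain ⟨C, hC⟩ := exists_weightedBound_ouIntegral h hγ hγf hε hω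
  rw [etaPath_eq h hγ hγf hε hω]
  refine ⟨‖ε ^ (-(1 / α))‖ * C, hC.meas.const_smul (ε ^ (-(1 / α))), fun t ht => ?_⟩
  rw [norm_smul, mul_assoc]
  exact mul_le_mul_of_nonneg_left (hC.bound t ht) (norm_nonneg _)

end Convergence

theorem xiPath_eq {ω : PathSpace n₂} (h : D.LinearBounds γs γf) (hγ : 0 < γ) (hγf : γ < -γf)
    (hω : Tempered ω) : D.xiPath ω = fun t => ouIntegral D.F (shift t ω).1 := by
  ext1 t
  have := hasStieltjesIntegralIic_kernel h hγ hγf one_pos hω t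
  rw [inv_one, one_smul] at this
  rw [xiPath, xi, this.stieltjesIntegralIic_eq]

/-- The two stationary processes are related by the self-similarity of the noise. -/
theorem etaPath_mul_eq {ω : PathSpace n₂} (h : D.LinearBounds γs γf) (hγ : 0 < γ)
    (hγf : γ < -γf) (hε : 0 < ε) (hω : Tempered ω) (t : ℝ) :
    D.etaPath α ε ω (ε * t) = D.xiPath (rescale α hε ω) t := by
  rw [etaPath_eq h hγ hγf hε hω, xiPath_eq h hγ hγf (hω.rescale α hε)]
  simp only [ouIntegral]
  have := integral_Iic_comp_mul_left (fun s => (ε⁻¹ • D.F)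
    (NormedSpace.exp ((-s) • (ε⁻¹ • D.F)) ((shift (ε * t) ω).1 s))) 0 hε
  rw [mul_zero] at this
  rw [this, ← integral_smul, ← integral_smul]
  congr 1
  ext1 s
  have e : (-(ε * s)) • (ε⁻¹ • D.F) = (-s) • D.F := by
    rw [smul_smul]
    congr 1
    field_simp
  -- Shifting by t after rescaling is rescaling after shifting by εt. The Jacobian ε cancels the ε⁻¹
  -- in ε⁻¹F.
  have e2 : (shift t (rescale α hε ω)).1 s = ε ^ (-(1 / α)) • (shift (ε * t) ω).1 (ε * s) := by
    simp only [shift, rescale, ← smul_sub, mul_add]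
  rw [e, e2, smul_apply, map_smul, map_smul, smul_smul, smul_smul]
  congr 1
  field_simp

/-- A change of the time scale in the Lyapunov–Perron iteration. -/
theorem picard_mul_eq (D : System n₁ n₂) (hε : 0 < ε) {z z' : ℝ → Euc n₂}
    (hz : ∀ t, z (ε * t) = z' t) (x₀ : Euc n₁) (k : ℕ) : ∀ t,
    (D.picard 1 ε⁻¹ z x₀ k).1 (ε * t) = (D.picard ε 1 z' x₀ k).1 t ∧
      (D.picard 1 ε⁻¹ z x₀ k).2 (ε * t) = (D.picard ε 1 z' x₀ k).2 t := by
  induction k with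
  | zero => exact fun t => ⟨rfl, rfl⟩
  | succ k ih =>
    intro t
    constructor
    · simp only [picard, slowMap, one_mul, one_smul]
      -- The Jacobian ε of s → εs becomes the coefficient of the slow equation; in the fast equation
      -- it cancels the factor ε⁻¹.
      have := intervalIntegral.smul_integral_comp_mul_left (a := 0) (b := t)
        (fun s => NormedSpace.exp ((ε * t - s) • D.S) (D.g₁ ((D.picard 1 ε⁻¹ z x₀ k).1 s)
          ((D.picard 1 ε⁻¹ z x₀ k).2 s + D.σ • z s))) ε
      rw [mul_zero] at this
      rw [← this]
      simp only [(ih _).1, (ih _).2, hz, mul_sub]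
    · simp only [picard, fastMap, one_mul, one_smul]
      rw [integral_Iic_comp_mul_left _ _ hε, smul_smul, inv_mul_cancel₀ hε.ne', one_smul]
      simp only [(ih _).1, (ih _).2, hz, ← mul_sub, inv_mul_cancel_left₀ hε.ne']

/-! ### Measurability of the Lyapunov–Perron iterates -/

/-- Joint measurability in (ω, t) is the right induction hypothesis, because the next iterate
integrates over time. -/
theorem measurable_picard (h : D.LipschitzNonlinearities K) {Ω : Type*} [MeasurableSpace Ω]
    {Z : Ω → ℝ → Euc n₂} (hZ : Measurable fun p : Ω × ℝ => Z p.1 p.2) (a b : ℝ) (x₀ : Euc n₁)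
    (k : ℕ) :
    Measurable (fun p : Ω × ℝ => (D.picard a b (Z p.1) x₀ k).1 p.2) ∧
      Measurable (fun p : Ω × ℝ => (D.picard a b (Z p.1) x₀ k).2 p.2) := by
  induction k with
  | zero => exact ⟨measurable_const, measurable_const⟩
  | succ k ih =>
    have hq : Measurable fun q : (Ω × ℝ) × ℝ => (q.1.1, q.2) :=
      measurable_fst.fst.prodMk measurable_snd
    have hxy : Measurable fun q : (Ω × ℝ) × ℝ => ((D.picard a b (Z q.1.1) x₀ k).1 q.2,
        (D.picard a b (Z q.1.1) x₀ k).2 q.2 + D.σ • Z q.1.1 q.2) :=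
      (ih.1.comp hq).prodMk ((ih.2.comp hq).add ((hZ.comp hq).const_smul D.σ))
    have hg₁ := (continuous_of_lipschitz_add h.g₁_lip).measurable.comp hxy
    have hg₂ := (continuous_of_lipschitz_add h.g₂_lip).measurable.comp hxy
    have hexp : ∀ {m : ℕ} (A : Euc m →L[ℝ] Euc m) (c : ℝ) {v : (Ω × ℝ) × ℝ → Euc m},
        Measurable v → Measurable fun q : (Ω × ℝ) × ℝ =>
          NormedSpace.exp ((c * (q.1.2 - q.2)) • A) (v q) := by
      intro m A c v hv
      have h1 : Measurable fun q : (Ω × ℝ) × ℝ => c * (q.1.2 - q.2) := by fun_prop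
      exact (isBoundedBilinearMap_apply (𝕜 := ℝ) (E := Euc m)
        (F := Euc m)).continuous.measurable.comp
        (((continuous_exp_smul A).measurable.comp h1).prodMk hv)
    constructor
    · have h1 : Measurable fun p : Ω × ℝ => NormedSpace.exp ((a * p.2) • D.S) x₀ :=
        (((continuous_exp_smul D.S).comp (by fun_prop : Continuous fun t : ℝ => a * t)).clm_apply
          continuous_const).measurable.comp measurable_snd
      exact h1.add ((measurable_intervalIntegral_zero (hexp D.S a hg₁)).const_smul a)
    · exact (measurable_integral_Iic (hexp D.F b hg₂)).const_smul b

/-! ### The two random systems -/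

section Systems

variable (hL : D.LinearBounds γs γf) (hN : D.LipschitzNonlinearities K) (hK : 0 < K)
  (hγs : 0 < γs) (hγ : 0 < γ) (hγf : K < -(γ + γf)) (hε : 0 < ε)
  (hrate : ε * K / γ + K / -(γ + γf) < 1)
include hL hN hK hγs hγ hγf hε hrate

section Tempered

variable {ω : PathSpace n₂} (hω : Tempered ω)
include hω

/-- The contraction constant is εK/(εγs + γ) + K/(-(γ+γf)); dropping εγs leaves the bound assumed in
`hrate`. -/
theorem isContractive_tilde : D.IsContractive ε 1 (-γ) K γs γf (D.xiPath ω) := by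
  refine ⟨hL, hN, hK.le, hγs, hε, one_pos, neg_neg_of_pos hγ, by linarith, ?_, ?_⟩
  · refine lt_of_le_of_lt (add_le_add ?_ (le_of_eq ?_)) hrate
    · refine div_le_div_of_nonneg_left (by positivity) hγ ?_
      nlinarith [mul_pos hε hγs]
    · rw [one_mul, one_mul, show -γ - γf = -(γ + γf) by ring]
  · rw [xiPath_eq hL hγ (by linarith) hω]
    have := exists_weightedBound_ouIntegral hL hγ (by linarith : γ < -γf) one_pos hω
    rwa [inv_one, one_smul, div_one] at this

/-- The constant K/(γs + γ/ε) + ε⁻¹K/(ε⁻¹(-(γ+γf))) equals that of the other system after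
multiplication of numerators and denominators by ε. -/
theorem isContractive_hat : D.IsContractive 1 ε⁻¹ (-γ / ε) K γs γf (D.etaPath α ε ω) := by
  have hm : 0 < -(γ + γf) := hK.trans hγf
  refine ⟨hL, hN, hK.le, hγs, one_pos, inv_pos.2 hε, div_neg_of_neg_of_pos (neg_neg_of_pos hγ) hε,
    ?_, ?_, exists_weightedBound_etaPath hL hγ (by linarith) hε hω⟩
  · rw [inv_mul_eq_div]
    exact div_lt_div_of_pos_right (by linarith) hε
  · refine lt_of_le_of_lt (add_le_add ?_ (le_of_eq ?_)) hrate
    · rw [div_le_div_iff₀ (by rw [neg_div, sub_neg_eq_add]; positivity) hγ]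
      have : ε * K * (1 * γs - -γ / ε) = ε * K * γs + K * γ := by field_simp; ring
      rw [this]
      nlinarith [mul_pos (mul_pos hε hK) hγs]
    · rw [show -γ / ε - ε⁻¹ * γf = ε⁻¹ * -(γ + γf) by ring,
        mul_div_mul_left _ _ (inv_pos.2 hε).ne']

theorem wellDefinedAt : D.WellDefinedAt α γ ε ω := by
  have hc := isContractive_tilde hL hN hK hγs hγ hγf hε hrate hω
  have hc' := isContractive_hat (α := α) hL hN hK hγs hγ hγf hε hrate hω
  exact ⟨fun t => ⟨_, hasStieltjesIntegralIic_kernel hL hγ (by linarith) hε hω t⟩,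
    fun t => ⟨_, hasStieltjesIntegralIic_kernel hL hγ (by linarith) one_pos hω t⟩,
    hc'.uniquelySolvable, hc.uniquelySolvable, hc'.slowManifold_eq, hc.slowManifold_eq⟩

/-- On rescaled paths, the two slow manifolds coincide. -/
theorem hHat_eq_hTilde_rescale (x₀ : Euc n₁) :
    D.hHat α γ ε ω x₀ = D.hTilde γ ε (rescale α hε ω) x₀ := by
  have h1 := (isContractive_hat (α := α) hL hN hK hγs hγ hγf hε hrate
    hω).tendsto_picard_lyapunovPerronMap x₀
  have h2 := (isContractive_tilde hL hN hK hγs hγ hγf hε hrate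
    (hω.rescale α hε)).tendsto_picard_lyapunovPerronMap x₀
  refine tendsto_nhds_unique h1 (h2.congr fun k => ?_)
  have := (D.picard_mul_eq hε (fun t => etaPath_mul_eq (α := α) hL hγ (by linarith) hε hω t) x₀ k
    0).2
  rw [mul_zero] at this
  exact this.symm

end Tempered

/-- Outside one null set, which does not depend on x₀, the field is the limit of Picard iterates for
a jointly measurable version of the forcing. For the product σ-algebra measurability at each x₀
suffices, but the modification must serve all x₀ simultaneously. -/
theorem aemeasurable_hTilde {P : Measure (PathSpace n₂)} (hP : ∀ᵐ ω ∂P, Tempered ω) :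
    AEMeasurable (fun ω x₀ => D.hTilde γ ε ω x₀) P := by
  classical
  obtain ⟨N, hsub, hNm, hN0⟩ := exists_measurable_superset_of_null hP
  have hmem : ∀ ω, ω ∉ N → Tempered ω := fun ω hω => by
    by_contra hT
    exact hω (hsub hT)
  let Z : PathSpace n₂ → ℝ → Euc n₂ := fun ω t => ouIntegral D.F (shift t ω).1
  have hZm : Measurable fun p : PathSpace n₂ × ℝ => Z p.1 p.2 := measurable_ouIntegral_shift D.F
  have hZ : ∀ ω, ω ∉ N → D.xiPath ω = Z ω := fun ω hω =>
    xiPath_eq hL hγ (by linarith) (hmem ω hω)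
  clear_value Z
  have hmeas : ∀ x₀ : Euc n₁,
      Measurable fun ω : PathSpace n₂ => if ω ∈ N then 0 else D.hTilde γ ε ω x₀ := by
    intro x₀
    have hk : ∀ k : ℕ, Measurable fun ω : PathSpace n₂ =>
        if ω ∈ N then 0 else (D.picard ε 1 (Z ω) x₀ k).2 0 := fun k => by
      have h1 := (measurable_picard hN hZm ε 1 x₀ k).2
      have h2 : Measurable fun ω => (D.picard ε 1 (Z ω) x₀ k).2 0 :=
        h1.comp (measurable_id.prodMk measurable_const)
      exact Measurable.ite hNm measurable_const h2
    refine measurable_of_tendsto_metrizable hk (tendsto_pi_nhds.2 fun ω => ?_)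
    by_cases hω : ω ∈ N
    · simp only [hω, if_true]
      exact tendsto_const_nhds
    · simp only [hω, if_false]
      have hT := hmem ω hω
      have hlim := (isContractive_tilde hL hN hK hγs hγ hγf hε hrate
        hT).tendsto_picard_lyapunovPerronMap x₀
      rw [hTilde]
      rwa [hZ ω hω] at hlim ⊢
  refine ⟨_, measurable_pi_lambda _ hmeas, ?_⟩
  filter_upwards [measure_eq_zero_iff_ae_notMem.1 hN0] with ω hω
  simp only [hω, if_false]

end Systems

end System

end

end SlowFast

end

/-! ### Equality in law of the two slow manifolds -/

theorem lemma8
    (K γ γs γf : ℝ) (hK : 0 < K) (hγs : 0 < γs) (hγf : γf < 0) (hA3 : K < -γf)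
    (hγ : 0 < γ) (hKγ : K < -(γ + γf)) :
    ∃ δ : ℝ, 0 < δ ∧
      ∀ (n₁ n₂ : ℕ) (D : SlowFast.System n₁ n₂) (α : ℝ)
        (P : MeasureTheory.Measure (SlowFast.PathSpace n₂)),
        D.LinearBounds γs γf → D.LipschitzNonlinearities K → 0 < D.σ → 1 < α → α < 2 →
        MeasureTheory.IsProbabilityMeasure P → SlowFast.IsStableLevy α P →
        ∀ ε : ℝ, 0 < ε → ε < δ →
          -- the slow manifolds are defined, as graphs, for almost every path
          (∀ᵐ ω ∂P, D.WellDefinedAt α γ ε ω) ∧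
          -- they coincide in distribution, as random graphs
          ProbabilityTheory.IdentDistrib
            (fun (ω : SlowFast.PathSpace n₂) (x₀ : SlowFast.Euc n₁) => D.hHat α γ ε ω x₀)
            (fun (ω : SlowFast.PathSpace n₂) (x₀ : SlowFast.Euc n₁) => D.hTilde γ ε ω x₀) P P ∧
          -- in particular pointwise
          ∀ x₀ : SlowFast.Euc n₁,
            ProbabilityTheory.IdentDistrib
              (fun ω : SlowFast.PathSpace n₂ => D.hHat α γ ε ω x₀)
              (fun ω : SlowFast.PathSpace n₂ => D.hTilde γ ε ω x₀) P P := by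
  have hm : 0 < -(γ + γf) := hK.trans hKγ
  have hgap : 0 < 1 - K / -(γ + γf) := sub_pos.2 ((div_lt_one hm).2 hKγ)
  -- This δ is the value of ε at which εK/γ + K/(-(γ+γf)) equals 1.
  refine ⟨γ * (1 - K / -(γ + γf)) / K, by positivity, ?_⟩
  intro n₁ n₂ D α P hL hN _ hα _ hP hS ε hε hεδ
  have hrate : ε * K / γ + K / -(γ + γf) < 1 := by
    rw [lt_div_iff₀ hK] at hεδ
    have : ε * K / γ < 1 - K / -(γ + γf) := (div_lt_iff₀' hγ).2 hεδ
    linarith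
  have htemp : ∀ᵐ ω ∂P, SlowFast.Tempered ω := hS.ae_growth hα
  have hmp := hS.measurePreserving_rescale hε
  have hmeas := SlowFast.System.aemeasurable_hTilde hL hN hK hγs hγ hKγ hε hrate htemp
  have hmeas' : AEMeasurable (fun ω x₀ => D.hTilde γ ε (SlowFast.rescale α hε ω) x₀) P :=
    AEMeasurable.comp_quasiMeasurePreserving hmeas hmp.quasiMeasurePreserving
  have hEq : (fun ω x₀ => D.hHat α γ ε ω x₀) =ᵐ[P]
      fun ω x₀ => D.hTilde γ ε (SlowFast.rescale α hε ω) x₀ := by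
    filter_upwards [htemp] with ω hω
    funext x₀
    exact SlowFast.System.hHat_eq_hTilde_rescale hL hN hK hγs hγ hKγ hε hrate hω x₀
  have hfield : ProbabilityTheory.IdentDistrib
      (fun (ω : SlowFast.PathSpace n₂) (x₀ : SlowFast.Euc n₁) => D.hHat α γ ε ω x₀)
      (fun (ω : SlowFast.PathSpace n₂) (x₀ : SlowFast.Euc n₁) => D.hTilde γ ε ω x₀) P P := by
    -- Almost surely ĥ is h̃ composed with a map preserving `P`, so both fields push `P` forward to
    -- the same law.
    refine ⟨hmeas'.congr hEq.symm, hmeas, ?_⟩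
    rw [Measure.map_congr hEq]
    have := AEMeasurable.map_map_of_aemeasurable (hmp.map_eq.symm ▸ hmeas) hmp.measurable.aemeasurable
    rw [hmp.map_eq] at this
    exact this.symm
  refine ⟨?_, hfield, fun x₀ => hfield.comp (measurable_pi_apply x₀)⟩
  filter_upwards [htemp] with ω hω
  exact SlowFast.System.wellDefinedAt hL hN hK hγs hγ hKγ hε hrate hω
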